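/- Work in ZFC. For an infinite regular cardinal $\theta$, $H_\theta$ is the set of all sets that are hereditarily of cardinality less than $\theta$, and $M\prec N$ means that $(M,\in)$ is an elementary submodel of $(N,\in)$. A set $M$ is $<\!\kappa$-closed if $M^{<\kappa}\subseteq M$, i.e. every function from an ordinal $\alpha<\kappa$ into $M$ is an element of $M$; a set $M \subseteq H_\theta$ is weakly $<\!\lambda$-closed if $M\cap H_\theta^{<\lambda}\subseteq M^{<\lambda}$, i.e. every element of $M$ that is a function from an ordinal $\alpha<\lambda$ into $H_\theta$ has all its values in $M$. For infinite cardinals $\lambda\ge\eta\ge\kappa$ with $\eta,\kappa$ regular, $\mathrm{VWS}(\lambda,\eta,\kappa)$ says that there are a sequence $\langle C_\alpha:\alpha<\lambda^+\rangle$ of sets of ordinals and a club $D\subseteq\lambda^+$ such that for each $\alpha\in D$ with $\mathrm{cf}(\alpha)\ge\eta$: $C_\alpha$ is a cofinal subset of $\alpha\cap D$ of order type $\mathrm{cf}(\alpha)$, and for each $X\in[C_\alpha]^{<\kappa}$ there is $\xi<\alpha$ with $X\subseteq C_\xi\in[C_\alpha]^{<\kappa}$. $\mathrm{VWS}$ says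 that $\mathrm{VWS}(\lambda,\eta,\kappa)$ holds for all such $\lambda,\eta,\kappa$. A $\kappa$-sage Davies tree for $\mu$ over $p$ (with respect to $H_\theta$) is a sequence $\langle M_\alpha:\alpha<\mu\rangle$ of elementary submodels of $H_\theta$ such that 1. $p\in M_\alpha$, $M_\alpha$ is $<\!\kappa$-closed and $|M_\alpha|=\kappa$ for all $\alpha<\mu$; 2. $[\mu]^{<\kappa}\subseteq\bigcup_{\alpha<\mu}M_\alpha$; 3. for each $\alpha<\mu$ there is a set $\mathcal N_\alpha$ with $|\mathcal N_\alpha|<\kappa$ of $<\!\kappa$-closed elementary submodels of $H_\theta$, each containing $p$ as an element, such that $\bigcup_{\xi<\alpha}M_\xi=\bigcup\mathcal N_\alpha$; 4. $\langle M_\alpha:\alpha<\beta\rangle\in M_\beta$ for each $\beta<\mu$; 5. $\bigcup_{\alpha<\mu}M_\alpha$ is a $<\!\kappa$-closed elementary submodel of $H_\theta$. A closed long $\kappa^+$-approximation sequence over $p$ of length $\mu$ (with respect to $H_\theta$) is a sequence $\langle M_\alpha:\alpha<\mu\rangle$ of elementary submodels of $H_\theta$ such that for each $\alpha<\mu$: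 $p\in M_\alpha$, $M_\alpha$ is weakly $<\!\kappa^+$-closed and $<\!\kappa$-closed, $|M_\alpha|<\kappa^+$, and $\langle M_\xi:\xi<\alpha\rangle\in M_\alpha$. **Theorem.** Assume $\mathrm{GCH}$ and $\mathrm{VWS}$, let $\kappa<\mu$ be infinite regular cardinals, and let $p$ be any set. Then for every sufficiently large regular cardinal $\theta$ there is a $\kappa$-sage Davies tree for $\mu$ over $p$ with respect to $H_\theta$; moreover, every closed long $\kappa^+$-approximation sequence over $p$ of length $\mu$ with respect to $H_\theta$ is a $\kappa$-sage Davies tree for $\mu$ over $p$ with respect to $H_\theta$. -/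

import Mathlib

open Cardinal

universe u

namespace Davies

/-! The set-theoretic universe is `ZFSet.{u}`; cardinals and ordinals are those of the same
universe level `u`. -/

/-- The generalized continuum hypothesis. -/
def GCH : Prop :=
  ∀ c : Cardinal.{u}, ℵ₀ ≤ c → (2 : Cardinal.{u}) ^ c = Order.succ c

/-- The Very Weak Square principle for `(lam, η, κ)`: a sequence `C` of sets of ordinals, indexed
by the ordinals below `lam⁺`, and a club `D` in `lam⁺`. Values of `C` at indices `≥ lam⁺` play no
role. -/
def VeryWeakSquare (lam η κ : Cardinal.{u}) : Prop :=
  ∃ (C : Ordinal.{u} → Set Ordinal.{u}) (D : Set Ordinal.{u}),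
    D ⊆ Set.Iio (Order.succ lam).ord ∧
    IsClub {a : Set.Iio (Order.succ lam).ord | (a : Ordinal.{u}) ∈ D} ∧
    ∀ α ∈ D, η ≤ α.cof →
      -- `C α` is a cofinal subset of `α ∩ D`, of order type `cf α`
      (C α ⊆ Set.Iio α ∩ D ∧ (∀ β ∈ Set.Iio α ∩ D, ∃ γ ∈ C α, β ≤ γ) ∧
        Nonempty (C α ≃o Set.Iio α.cof.ord)) ∧
      -- every `X ∈ [C α]^{<κ}` is covered by some earlier `C ξ ∈ [C α]^{<κ}`
      ∀ X : Set Ordinal.{u}, X ⊆ C α → #X < Cardinal.lift.{u + 1} κ →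
        ∃ ξ < α, X ⊆ C ξ ∧ C ξ ⊆ C α ∧ #(C ξ) < Cardinal.lift.{u + 1} κ

/-- The Very Weak Square principle for all admissible triples of cardinals. -/
def VWS : Prop :=
  ∀ lam η κ : Cardinal.{u}, ℵ₀ ≤ lam → η.IsRegular → κ.IsRegular → κ ≤ η → η ≤ lam →
    VeryWeakSquare lam η κ

/-- The only symbol of the language of set theory is a binary relation symbol. -/
inductive MemRel : ℕ → Type
  | mem : MemRel 2

/-- The first-order language of set theory. -/
def setLanguage : FirstOrder.Language := ⟨fun _ => Empty, MemRel⟩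

/-- Every class `S` of sets is viewed as the structure `(S, ∈)`. -/
instance memStructure (S : Set ZFSet.{u}) : setLanguage.Structure S where
  funMap := fun f _ => nomatch f
  RelMap := fun r => match r with
    | .mem => fun v => (v 0 : ZFSet.{u}) ∈ (v 1 : ZFSet.{u})

/-- `M ≺ N`: the inclusion map is an elementary embedding of `(M, ∈)` into `(N, ∈)`. -/
def IsElementarySubmodel (M N : Set ZFSet.{u}) : Prop :=
  ∃ j : setLanguage.ElementaryEmbedding M N, ∀ x : M, (j x : ZFSet.{u}) = x

/-- `H_θ`: the sets hereditarily of cardinality less than `θ`. -/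
def H (θ : Cardinal.{u}) : Set ZFSet.{u} :=
  {x | ZFSet.Hereditarily (fun y => y.card < θ) x}

/-- `M` is `<κ`-closed: `M^{<κ} ⊆ M`, where `M^{<κ}` is the set of all functions from an ordinal
`α < κ` into `M`. -/
def IsClosedUnder (κ : Cardinal.{u}) (M : ZFSet.{u}) : Prop :=
  ∀ α < κ.ord, ZFSet.funs α.toZFSet M ⊆ M

/-- `M` is weakly `<lam`-closed (relative to `H_θ`): `M ∩ H_θ^{<lam} ⊆ M^{<lam}`. -/
def IsWeaklyClosedUnder (θ lam : Cardinal.{u}) (M : ZFSet.{u}) : Prop :=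
  ∀ f ∈ M, ∀ α < lam.ord,
    (∃ Y : ZFSet.{u}, (∀ y ∈ Y, y ∈ H θ) ∧ f ∈ ZFSet.funs α.toZFSet Y) →
      f ∈ ZFSet.funs α.toZFSet M

/-- The sequence `⟨M ξ : ξ < α⟩` as a set, i.e. as a set of ordered pairs. -/
noncomputable def initialSeq (M : Ordinal.{u} → ZFSet.{u}) (α : Ordinal.{u}) : ZFSet.{u} :=
  ZFSet.range (fun ξ : Set.Iio α => ZFSet.pair (ξ : Ordinal.{u}).toZFSet (M ξ))

/-- The union `⋃_{ξ < α} M ξ`. -/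
noncomputable def initialUnion (M : Ordinal.{u} → ZFSet.{u}) (α : Ordinal.{u}) : ZFSet.{u} :=
  ZFSet.iUnion (fun ξ : Set.Iio α => M ξ)

/-- `⟨M α : α < μ⟩` is a `κ`-high Davies tree for `μ` over `p`, made of elementary submodels of
`H_θ`. Only the values of `M` at ordinals below `μ` matter. -/
structure IsHighDaviesTree (κ μ θ : Cardinal.{u}) (p : ZFSet.{u})
    (M : Ordinal.{u} → ZFSet.{u}) : Prop where
  elementary : ∀ α < μ.ord, IsElementarySubmodel (M α : Set ZFSet.{u}) (H θ)
  param_mem : ∀ α < μ.ord, p ∈ M α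
  closed : ∀ α < μ.ord, IsClosedUnder κ (M α)
  card_eq : ∀ α < μ.ord, (M α).card = κ
  cover : ∀ x : ZFSet.{u}, x ⊆ μ.ord.toZFSet → x.card < κ → x ∈ initialUnion M μ.ord
  decomposition : ∀ α < μ.ord, ∃ 𝒩 : ZFSet.{u}, 𝒩.card < κ ∧
    (∀ N ∈ 𝒩, IsElementarySubmodel (N : Set ZFSet.{u}) (H θ) ∧ IsClosedUnder κ N ∧ p ∈ N) ∧
    initialUnion M α = 𝒩.sUnion

/-- `⟨M α : α < μ⟩` is a `κ`-sage Davies tree for `μ` over `p`, made of elementary submodels of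
`H_θ`. -/
structure IsSageDaviesTree (κ μ θ : Cardinal.{u}) (p : ZFSet.{u})
    (M : Ordinal.{u} → ZFSet.{u}) : Prop extends IsHighDaviesTree κ μ θ p M where
  initialSeq_mem : ∀ β < μ.ord, initialSeq M β ∈ M β
  union_elementary : IsElementarySubmodel (initialUnion M μ.ord : Set ZFSet.{u}) (H θ)
  union_closed : IsClosedUnder κ (initialUnion M μ.ord)

/-- `⟨M α : α < len⟩` is a long `lam`-approximation sequence over `p`, made of elementary
submodels of `H_θ`. -/
structure IsLongApproxSeq (lam θ : Cardinal.{u}) (p : ZFSet.{u}) (len : Ordinal.{u})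
    (M : Ordinal.{u} → ZFSet.{u}) : Prop where
  elementary : ∀ α < len, IsElementarySubmodel (M α : Set ZFSet.{u}) (H θ)
  param_mem : ∀ α < len, p ∈ M α
  weaklyClosed : ∀ α < len, IsWeaklyClosedUnder θ lam (M α)
  card_lt : ∀ α < len, (M α).card < lam
  initialSeq_mem : ∀ α < len, initialSeq M α ∈ M α

/-- `⟨M α : α < len⟩` is a closed long `κ⁺`-approximation sequence over `p`. -/
structure IsClosedLongApproxSeq (κ θ : Cardinal.{u}) (p : ZFSet.{u}) (len : Ordinal.{u})
    (M : Ordinal.{u} → ZFSet.{u}) : Prop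
    extends IsLongApproxSeq (Order.succ κ) θ p len M where
  closed : ∀ α < len, IsClosedUnder κ (M α)

end Davies

-- Let `M` be a closed long approximation sequence. If `ξ < η` and `ξ ∈ M η`, then `M ξ ∈ M η`, as a
-- value of the initial sequence; and since `M ξ` has size `κ` while `κ` is both an element and a
-- subset of `M η`, also `M ξ ⊆ M η`. Inclusion between the models is thus controlled by ordinals.
-- Suppose `E η` is a set of ordinals with `E η ∩ [0, η] ⊆ M η`. If every small (size `< κ`) subset
-- of `W` lies in `E η ∩ [0, η]` for some `η ∈ W`, then the models indexed by `W` form a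
-- `<κ`-directed family, and their union is a `<κ`-closed elementary submodel. It remains to find
-- `E` for which `μ` itself is such a `W` and every `α < μ` is a union of fewer than `κ` of them.
--
-- Combinatorics (`exists_covering`): for each cardinal `χ ≥ κ` such an `E`, with all values of size
-- at most `κ`, is built on `[χ, χ⁺)` by induction on `χ`. The interval is cut into blocks `[χβ, χβ
-- + χ)`, each carrying a copy of the coverings already built below `χ`. Only limits `β` of
-- cofinality at least `κ` remain. If `cf χ ≥ κ`, then by GCH `χβ` has only `χ` small subsets, so
-- one block can list them all. If `cf χ < κ` this count may fail; very weak square then reduces the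
-- sets to be listed to few enough, level by level along a filtration of length `cf χ`.
--
-- Transfer (`exists_cover`): a code of `E` exists in `H θ`, so by elementarity one lies in `M χ`.
-- For `η ∈ [χ, χ⁺)` the cardinal `χ = |η|` belongs to `M η`, hence so does the code. As `E η` is
-- enumerated by `κ ⊆ M η`, all its coded elements lie in `M η`.
--
-- Existence of approximation sequences is a recursion in which GCH, through `κ^{<κ} = κ`, keeps the
-- closed models of size `κ`.

universe v

/-! ### Cover-closed sets and decompositions -/

namespace Davies

open Ordinal Order Set

/-- Every subset of `W` of size `< κ` is contained in `E η ∩ [0, η]` for some `η ∈ W`. -/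
def CoverClosed (κ : Cardinal.{u}) (E : Ordinal.{u} → Set Ordinal.{u}) (W : Set Ordinal.{u}) :
    Prop :=
  ∀ X ⊆ W, #X < Cardinal.lift.{u + 1} κ → ∃ η ∈ W, X ⊆ E η ∩ Iic η

/-- `S` is the union of fewer than `κ` many sets that are cover-closed for `E`. -/
def Decomposes (κ : Cardinal.{u}) (E : Ordinal.{u} → Set Ordinal.{u}) (S : Set Ordinal.{u}) :
    Prop :=
  ∃ 𝒲 : Set (Set Ordinal.{u}), #𝒲 < Cardinal.lift.{u + 1} κ ∧ ⋃₀ 𝒲 = S ∧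
    ∀ W ∈ 𝒲, CoverClosed κ E W

/-- `E` covers all small subsets of `χ⁺`, and it decomposes all intervals `[χ, α)`, `α < χ⁺`. -/
structure IsCovering (κ χ : Cardinal.{u}) (E : Ordinal.{u} → Set Ordinal.{u}) : Prop where
  cover : ∀ X ⊆ Iio (succ χ).ord, #X < Cardinal.lift.{u + 1} κ →
    ∃ η ∈ Ico χ.ord (succ χ).ord, X ⊆ E η ∩ Iic η
  decomposes : ∀ α < (succ χ).ord, Decomposes κ E (Ico χ.ord α)

section Basic

variable {κ χ : Cardinal.{u}} {E E' : Ordinal.{u} → Set Ordinal.{u}} {S S' W : Set Ordinal.{u}}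

/-- All the covering notions survive enlarging `E`, so coverings made for different purposes can be
merged by taking unions pointwise. -/
theorem CoverClosed.congr (h : CoverClosed κ E W) (hE : ∀ η ∈ W, E η ⊆ E' η) :
    CoverClosed κ E' W := fun X hX hc ↦ by
  obtain ⟨η, hη, hXη⟩ := h X hX hc
  exact ⟨η, hη, hXη.trans (inter_subset_inter_left _ (hE η hη))⟩

theorem Decomposes.congr (h : Decomposes κ E S) (hE : ∀ η ∈ S, E η ⊆ E' η) :
    Decomposes κ E' S := by
  obtain ⟨𝒲, h1, rfl, h2⟩ := h
  exact ⟨𝒲, h1, rfl, fun W hW ↦ (h2 W hW).congr fun η hη ↦ hE η ⟨W, hW, hη⟩⟩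

theorem IsCovering.congr (h : IsCovering κ χ E) (hE : ∀ η ∈ Ico χ.ord (succ χ).ord, E η ⊆ E' η) :
    IsCovering κ χ E' where
  cover X hX hc := by
    obtain ⟨η, hη, hXη⟩ := h.cover X hX hc
    exact ⟨η, hη, hXη.trans (inter_subset_inter_left _ (hE η hη))⟩
  decomposes α hα := (h.decomposes α hα).congr fun η hη ↦ hE η ⟨hη.1, hη.2.trans hα⟩

theorem Decomposes.iUnion (hκ : κ.IsRegular) {ι : Type (u + 1)}
    (hι : #ι < Cardinal.lift.{u + 1} κ) {S : ι → Set Ordinal.{u}}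
    (h : ∀ i, Decomposes κ E (S i)) : Decomposes κ E (⋃ i, S i) := by
  choose 𝒲 h1 h2 h3 using h
  refine ⟨⋃ i, 𝒲 i, ?_, ?_, ?_⟩
  · exact (card_iUnion_lt_iff_forall_of_isRegular hκ.lift hι).2 h1
  · rw [sUnion_iUnion]; exact iUnion_congr h2
  · simp only [mem_iUnion]
    rintro W ⟨i, hW⟩
    exact h3 i W hW

theorem CoverClosed.decomposes (hκ : κ.IsRegular) (h : CoverClosed κ E S) :
    Decomposes κ E S := by
  refine ⟨{S}, ?_, by simp, by simpa⟩
  simpa using one_lt_aleph0.trans_le hκ.aleph0_le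

theorem decomposes_empty (hκ : κ.IsRegular) : Decomposes κ E ∅ :=
  ⟨∅, by simpa using hκ.pos, by simp, by simp⟩

theorem Decomposes.union (hκ : κ.IsRegular) (h : Decomposes κ E S) (h' : Decomposes κ E S') :
    Decomposes κ E (S ∪ S') := by
  obtain ⟨𝒲, h1, rfl, h2⟩ := h
  obtain ⟨𝒲', h1', rfl, h2'⟩ := h'
  refine ⟨𝒲 ∪ 𝒲', ?_, by rw [sUnion_union], fun W hW ↦ hW.elim (h2 W) (h2' W)⟩
  exact (mk_union_le _ _).trans_lt (add_lt_of_lt hκ.lift.aleph0_le h1 h1')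

theorem exists_bound {α : Ordinal.{u}} {X : Set Ordinal.{u}} (hX : X ⊆ Iio α)
    (hc : #X < Cardinal.lift.{u + 1} α.cof) : ∃ β < α, X ⊆ Iic β := by
  rw [lift_cof] at hc
  refine ⟨sSup X, sSup_lt_of_lt_cof hc hX, fun x hx ↦ ?_⟩
  exact le_csSup ⟨α, fun y hy ↦ (hX hy).le⟩ hx

/-- By continuity `f α` is the supremum of `f` along a cofinal sequence of length `cf α < κ`, and
fewer than `κ` decompositions may be combined. It serves for `f = id` and for `f = χ * ·`. -/
theorem Decomposes.of_cof_lt (hκ : κ.IsRegular) {f : Ordinal.{u} → Ordinal.{u}} (hf : IsNormal f)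
    {a α : Ordinal.{u}} (hα : IsSuccLimit α) (hc : α.cof < κ)
    (h : ∀ β < α, Decomposes κ E (Ico a (f β))) : Decomposes κ E (Ico a (f α)) := by
  obtain ⟨g, hg⟩ := exists_isFundamentalSeq (o := α) rfl
  have := Decomposes.iUnion (E := E) hκ (ι := Iio α.cof.ord) (by
    rwa [Cardinal.mk_Iio_ordinal, card_ord, Cardinal.lift_lt])
    (S := fun i ↦ Ico a (f (g i))) fun i ↦ h _ (g i).2
  convert this using 1
  ext x
  simp only [mem_iUnion, mem_Ico]
  constructor
  · rintro ⟨h1, h2⟩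
    obtain ⟨β, hβ, hx⟩ := (hf.lt_iff_exists_lt hα).1 h2
    obtain ⟨_, ⟨i, rfl⟩, hi⟩ := hg.isCofinal_range ⟨β, hβ⟩
    exact ⟨i, h1, hx.trans_le (hf.strictMono.monotone hi)⟩
  · rintro ⟨i, h1, h2⟩
    exact ⟨h1, h2.trans (hf.strictMono (g i).2)⟩

theorem ord_card_le_lt (α : Ordinal.{u}) : α.card.ord ≤ α ∧ α < (succ α.card).ord :=
  ⟨ord_card_le α, lt_ord.2 (lt_succ _)⟩

/-- A small set is bounded by some `β < lam`, hence contained in `χ⁺` for `χ = max |β| κ < lam`; the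
covering at `χ` supplies an index below `χ⁺ ≤ lam`. -/
theorem CoverClosed.Iio_of_isCovering {lam : Cardinal.{u}}
    (h0 : ∀ η < κ.ord, Iic η ⊆ E η) (h : ∀ χ, κ ≤ χ → χ < lam → IsCovering κ χ E)
    (hκl : κ ≤ lam) (hcof : κ ≤ lam.ord.cof) : CoverClosed κ E (Iio lam.ord) := by
  intro X hX hc
  obtain ⟨β, hβ, hXβ⟩ := exists_bound hX (hc.trans_le (Cardinal.lift_le.2 hcof))
  rcases hκl.eq_or_lt with rfl | hlt
  · exact ⟨β, hβ, fun x hx ↦ ⟨h0 β hβ (hXβ hx), hXβ hx⟩⟩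
  · have hχ : max β.card κ < lam := max_lt (lt_ord.1 hβ) hlt
    obtain ⟨η, hη, hXη⟩ := (h _ (le_max_right _ _) hχ).cover X (fun x hx ↦
      (hXβ hx).trans_lt ((ord_card_le_lt β).2.trans_le
        (ord_le_ord.2 (succ_le_succ (le_max_left _ _))))) hc
    exact ⟨η, hη.2.trans_le (ord_le_ord.2 (succ_le_of_lt hχ)), hXη⟩

/-- Induction on `α`. Ordinals below `κ` split into few initial segments with a maximum. A cardinal
is either cover-closed or of cofinality below `κ`. Otherwise `α` is `|α|` followed by `[|α|, α)`,
which the covering at `|α|` decomposes. -/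
theorem decomposes_Iio (hκ : κ.IsRegular) {lam : Cardinal.{u}}
    (h0 : ∀ η < κ.ord, Iic η ⊆ E η) (h : ∀ χ, κ ≤ χ → χ < lam → IsCovering κ χ E)
    (α : Ordinal.{u}) (hα : α ≤ lam.ord) : Decomposes κ E (Iio α) := by
  induction α using WellFoundedLT.induction with | ind α ih =>
  rcases lt_or_ge α κ.ord with hακ | hακ
  · have := Decomposes.iUnion (E := E) hκ (ι := Iio α) (by
        rw [Cardinal.mk_Iio_ordinal, Cardinal.lift_lt]; exact lt_ord.1 hακ)
      (S := fun i ↦ Iic i.1) fun i ↦ by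
        refine CoverClosed.decomposes hκ fun X hX _ ↦ ⟨i.1, mem_Iic.2 le_rfl, fun x hx ↦ ⟨?_, hX hx⟩⟩
        exact h0 _ (i.2.trans hακ) (hX hx)
    convert this using 1
    ext x
    simp only [mem_Iio, mem_iUnion, mem_Iic, Subtype.exists, exists_prop]
    exact ⟨fun hx ↦ ⟨x, hx, le_rfl⟩, fun ⟨y, hy, hx⟩ ↦ hx.trans_lt hy⟩
  · have hκα : κ ≤ α.card := by simpa using card_le_card hακ
    obtain ⟨h1, h2⟩ := ord_card_le_lt α
    rcases h1.eq_or_lt with h1 | h1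
    · have hle : α.card ≤ lam := by simpa using card_le_card hα
      by_cases hcof : κ ≤ α.cof
      · rw [← h1]
        exact (CoverClosed.Iio_of_isCovering h0 (fun χ h3 h4 ↦ h χ h3 (h4.trans_le hle)) hκα
          (by rwa [h1])).decomposes hκ
      · have hlim : IsSuccLimit α := by
          rw [← h1]; exact isSuccLimit_ord (hκ.aleph0_le.trans hκα)
        have h5 (x : Ordinal.{u}) : Ico 0 (id x) = Iio x := by ext; simp
        simpa only [h5] using Decomposes.of_cof_lt (E := E) (a := 0) hκ IsNormal.id hlim
          (not_le.1 hcof) fun β hβ ↦ by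
            rw [h5]; exact ih β hβ (hβ.le.trans hα)
    · have hlt : α.card < lam := by
        rw [← ord_lt_ord]; exact h1.trans_le hα
      have := (ih _ h1 (h1.le.trans hα)).union hκ ((h _ hκα hlt).decomposes α h2)
      rwa [Iio_union_Ico_eq_Iio h1.le] at this

end Basic

end Davies

namespace Davies

open Ordinal Order Set

/-! ### Counting small subsets under GCH -/

section Counting

variable {κ c : Cardinal.{u}}

theorem mk_iUnion_le_of_le {ι α : Type v} {c : Cardinal.{v}} {f : ι → Set α} (hc : ℵ₀ ≤ c)
    (hι : #ι ≤ c) (hf : ∀ i, #(f i) ≤ c) : #(⋃ i, f i) ≤ c :=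
  (mk_iUnion_le f).trans <| (mul_le_mul' hι (ciSup_le' hf)).trans_eq (mul_eq_self hc)

/-- Under `GCH`, a set of size `c` with `κ ≤ cf c` has only `c` many subsets of size `< κ`. -/
theorem mk_small_subsets_Iio_le (hGCH : GCH.{u}) (hc : ℵ₀ ≤ c) (hcof : κ ≤ c.ord.cof) :
    #{X : Set Ordinal.{u} | X ⊆ Iio c.ord ∧ #X < Cardinal.lift.{u + 1} κ} ≤
      Cardinal.lift.{u + 1} c := by
  -- Because `κ ≤ cf c`, every small set is bounded; and each `β < c` has at most `c` subsets by
  -- GCH.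
  have hsub : {X : Set Ordinal.{u} | X ⊆ Iio c.ord ∧ #X < Cardinal.lift.{u + 1} κ} ⊆
      ⋃ i : Iio c.ord, 𝒫 (Iio (succ i.1)) := by
    rintro X ⟨hX, hXc⟩
    obtain ⟨β, hβ, hXβ⟩ := exists_bound hX (hXc.trans_le (Cardinal.lift_le.2 hcof))
    exact mem_iUnion.2 ⟨⟨β, hβ⟩, fun x hx ↦ mem_Iio.2 (lt_succ_iff.2 (hXβ hx))⟩
  refine (mk_le_mk_of_subset hsub).trans (mk_iUnion_le_of_le (by simpa) ?_ fun i ↦ ?_)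
  · rw [Cardinal.mk_Iio_ordinal, card_ord]
  · rw [mk_powerset, Cardinal.mk_Iio_ordinal, ← lift_two_power, Cardinal.lift_le]
    have hi : (succ i.1).card < c := lt_ord.1 ((isSuccLimit_ord hc).succ_lt i.2)
    rcases lt_or_ge (succ i.1).card ℵ₀ with h | h
    · exact ((power_lt_aleph0 (natCast_lt_aleph0 (n := 2)) h).trans_le hc).le
    · rw [hGCH _ h]; exact succ_le_of_lt hi

theorem mk_small_subsets_le (hGCH : GCH.{u}) (hc : ℵ₀ ≤ c) (hcof : κ ≤ c.ord.cof)
    {α : Type (u + 1)} {S : Set α} (hS : #S ≤ Cardinal.lift.{u + 1} c) :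
    #{X : Set α | X ⊆ S ∧ #X < Cardinal.lift.{u + 1} κ} ≤ Cardinal.lift.{u + 1} c := by
  rw [← card_ord c, ← Cardinal.mk_Iio_ordinal] at hS
  obtain ⟨f⟩ := hS
  refine le_trans ?_ (mk_small_subsets_Iio_le hGCH hc hcof)
  refine ⟨⟨fun X ↦ ⟨(fun x ↦ (f x).1) '' (Subtype.val ⁻¹' X.1), ?_, ?_⟩, ?_⟩⟩
  · rintro _ ⟨x, -, rfl⟩
    exact (f x).2
  · refine mk_image_le.trans_lt (lt_of_le_of_lt ?_ X.2.2)
    exact mk_le_of_injective (f := fun x : (Subtype.val ⁻¹' X.1 : Set S) ↦ (⟨x.1.1, x.2⟩ : X.1))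
      fun x y h ↦ by simpa [Subtype.ext_iff] using h
  · intro X Y h
    have hinj : Function.Injective fun x : S ↦ (f x).1 :=
      Subtype.val_injective.comp f.injective
    have := hinj.image_injective (congrArg Subtype.val h)
    ext x
    constructor
    · intro hx
      have h1 : (⟨x, X.2.1 hx⟩ : S) ∈ (Subtype.val ⁻¹' X.1 : Set S) := hx
      rw [this] at h1
      exact h1
    · intro hx
      have h1 : (⟨x, Y.2.1 hx⟩ : S) ∈ (Subtype.val ⁻¹' Y.1 : Set S) := hx
      rw [← this] at h1
      exact h1

theorem exists_enumeration {α : Type (u + 1)} (𝒳 : Set (Set α))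
    (h : #𝒳 ≤ Cardinal.lift.{u + 1} c) :
    ∃ e : Ordinal.{u} → Set α, (∀ X ∈ 𝒳, ∃ ζ < c.ord, e ζ = X) ∧ ∀ ζ, e ζ ∈ 𝒳 ∨ e ζ = ∅ := by
  classical
  rw [← card_ord c, ← Cardinal.mk_Iio_ordinal] at h
  obtain ⟨f⟩ := h
  refine ⟨fun ζ ↦ if h : ∃ X : 𝒳, (f X).1 = ζ then h.choose.1 else ∅, fun X hX ↦ ?_, fun ζ ↦ ?_⟩
  · refine ⟨(f ⟨X, hX⟩).1, (f ⟨X, hX⟩).2, ?_⟩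
    have h : ∃ Y : 𝒳, (f Y).1 = (f ⟨X, hX⟩).1 := ⟨_, rfl⟩
    beta_reduce
    rw [dif_pos h]
    exact congrArg Subtype.val (f.injective (Subtype.ext h.choose_spec))
  · by_cases h : ∃ X : 𝒳, (f X).1 = ζ
    · left
      beta_reduce
      rw [dif_pos h]
      exact h.choose.2
    · right
      beta_reduce
      rw [dif_neg h]

end Counting

/-! ### Ingredients: translated blocks, unbounded covers, limits when `cf χ ≥ κ` -/

section Steps

variable {κ χ : Cardinal.{u}}

theorem mk_Iio_le_of_lt_succ {α : Ordinal.{u}} (h : α < (succ χ).ord) :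
    #(Iio α) ≤ Cardinal.lift.{u + 1} χ := by
  rw [Cardinal.mk_Iio_ordinal, Cardinal.lift_le]
  exact lt_succ_iff.1 (lt_ord.1 h)

/-- Translates of a covering to the intervals `[χ * β, χ * β + r)`. -/
theorem exists_translate_covering {F : Ordinal.{u} → Set Ordinal.{u}} (θ : Ordinal.{u})
    (hF : ∀ η, #(F η) ≤ Cardinal.lift.{u + 1} κ) (hdec : ∀ r ≤ θ, Decomposes κ F (Iio r)) :
    ∃ E : Ordinal.{u} → Set Ordinal.{u}, (∀ η, #(E η) ≤ Cardinal.lift.{u + 1} κ) ∧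
      ∀ β, ∀ r ≤ θ, Decomposes κ E (Ico (θ * β) (θ * β + r)) := by
  -- The quotient names the block containing `η`, the remainder the position in it; `F` is shifted
  -- to that block.
  refine ⟨fun η ↦ (θ * (η / θ) + ·) '' F (η % θ), fun η ↦ mk_image_le.trans (hF _), ?_⟩
  intro β r hr
  obtain ⟨𝒲, h1, h2, h3⟩ := hdec r hr
  have himg : (θ * β + ·) '' Iio r = Ico (θ * β) (θ * β + r) := by
    ext x
    constructor
    · rintro ⟨y, hy, rfl⟩
      exact ⟨le_self_add, by simpa using hy⟩
    · rintro ⟨hx, hx'⟩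
      refine ⟨x - θ * β, ?_, Ordinal.add_sub_cancel_of_le hx⟩
      rw [← Ordinal.add_sub_cancel_of_le hx] at hx'
      exact lt_of_add_lt_add_left hx'
  refine ⟨image (θ * β + ·) '' 𝒲, mk_image_le.trans_lt h1, ?_, ?_⟩
  · rw [← himg, ← h2, sUnion_image, sUnion_eq_biUnion, image_iUnion₂]
  · rintro _ ⟨W, hW, rfl⟩ X hX hXc
    obtain ⟨Y, hY, rfl⟩ := subset_image_iff.1 hX
    have hinj : Function.Injective (θ * β + ·) := fun x y h ↦ by simpa using h
    rw [mk_image_eq hinj] at hXc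
    obtain ⟨η, hη, hYη⟩ := h3 W hW Y hY hXc
    have hηθ : η < θ := lt_of_lt_of_le (h2.subset ⟨W, hW, hη⟩) hr
    have hθ : θ ≠ 0 := (pos_of_gt hηθ).ne'
    refine ⟨θ * β + η, mem_image_of_mem _ hη, ?_⟩
    rintro _ ⟨y, hy, rfl⟩
    refine ⟨?_, ?_⟩
    · simp only [mul_add_div _ hθ, div_eq_zero_of_lt hηθ, add_zero, mul_add_mod_self,
        mod_eq_of_lt hηθ]
      exact mem_image_of_mem _ (hYη hy).1
    · simpa using (hYη hy).2

/-- By GCH there are at most `χ⁺` small subsets of `χ⁺`, so each can be listed `χ⁺` many times; some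
occurrence comes after `χ` and after a bound of the set. -/
theorem exists_unbounded_cover (hGCH : GCH.{u}) (hκ : κ.IsRegular) (hκχ : κ ≤ χ) :
    ∃ E : Ordinal.{u} → Set Ordinal.{u}, (∀ η, #(E η) ≤ Cardinal.lift.{u + 1} κ) ∧
      ∀ X ⊆ Iio (succ χ).ord, #X < Cardinal.lift.{u + 1} κ →
        ∃ η ∈ Ico χ.ord (succ χ).ord, X ⊆ E η ∩ Iic η := by
  classical
  have hχ : ℵ₀ ≤ χ := hκ.aleph0_le.trans hκχ
  have hreg : (succ χ).IsRegular := isRegular_succ hχ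
  have hcof : κ ≤ (succ χ).ord.cof := by
    rw [hreg.cof_ord]; exact hκχ.trans (le_succ χ)
  set 𝒳 := {X : Set Ordinal.{u} | X ⊆ Iio (succ χ).ord ∧ #X < Cardinal.lift.{u + 1} κ}
  have h𝒳 := mk_small_subsets_Iio_le hGCH hreg.aleph0_le hcof
  have hprod : #(𝒳 × Iio (succ χ).ord) ≤ #(Iio (succ χ).ord) := by
    rw [mk_prod, Cardinal.lift_id, Cardinal.lift_id, Cardinal.mk_Iio_ordinal, card_ord]
    refine (mul_le_mul_left h𝒳 _).trans_eq (mul_eq_self ?_)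
    rw [aleph0_le_lift]; exact hreg.aleph0_le
  obtain ⟨g⟩ := hprod
  refine ⟨fun η ↦ if h : ∃ p, (g p).1 = η then h.choose.1.1 else ∅, fun η ↦ ?_, fun X hX hXc ↦ ?_⟩
  · by_cases h : ∃ p, (g p).1 = η
    · beta_reduce; rw [dif_pos h]; exact h.choose.1.2.2.le
    · beta_reduce; rw [dif_neg h]; simp
  · obtain ⟨β, hβ, hXβ⟩ := exists_bound hX (hXc.trans_le (Cardinal.lift_le.2 hcof))
    have hδ : max β χ.ord < (succ χ).ord := max_lt hβ (ord_lt_ord.2 (lt_succ χ))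
    obtain ⟨i, hi⟩ : ∃ i, max β χ.ord ≤ (g (⟨X, hX, hXc⟩, i)).1 := by
      by_contra! hcon
      have hle : #(Iio (succ χ).ord) ≤ #(Iio (max β χ.ord)) :=
        mk_le_of_injective (f := fun i ↦ ⟨(g (⟨X, hX, hXc⟩, i)).1, hcon i⟩) fun i j hij ↦ by
          have h1 := congrArg Subtype.val hij
          exact (Prod.ext_iff.1 (g.injective (Subtype.ext h1))).2
      have := hle.trans (mk_Iio_le_of_lt_succ hδ)
      rw [Cardinal.mk_Iio_ordinal, card_ord, Cardinal.lift_le] at this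
      exact (lt_succ χ).not_ge this
    refine ⟨_, ⟨(le_max_right _ _).trans hi, (g (⟨X, hX, hXc⟩, i)).2⟩, fun x hx ↦ ⟨?_, ?_⟩⟩
    · have h : ∃ p, (g p).1 = (g (⟨X, hX, hXc⟩, i)).1 := ⟨_, rfl⟩
      beta_reduce
      rw [dif_pos h, g.injective (Subtype.ext h.choose_spec)]
      exact hx
    · exact (hXβ hx).trans ((le_max_left _ _).trans hi)

theorem isNormal_ord_mul (hχ : ℵ₀ ≤ χ) : IsNormal (χ.ord * ·) :=
  isNormal_mul_right (isSuccLimit_ord hχ).bot_lt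

theorem mul_lt_succ_ord (hχ : ℵ₀ ≤ χ) {β : Ordinal.{u}} (hβ : β < (succ χ).ord) :
    χ.ord * β < (succ χ).ord := by
  rw [lt_ord, card_mul, card_ord, lt_succ_iff]
  exact (mul_le_mul' le_rfl (lt_succ_iff.1 (lt_ord.1 hβ))).trans_eq (mul_eq_self hχ)

/-- If `κ ≤ cf χ`, then `[χ, χ * β)` can be made cover-closed for all limits `β < χ⁺` of
cofinality at least `κ`. -/
theorem exists_limit_covering_of_le_cof (hGCH : GCH.{u}) (hκ : κ.IsRegular) (hκχ : κ ≤ χ)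
    (hcof : κ ≤ χ.ord.cof) :
    ∃ E : Ordinal.{u} → Set Ordinal.{u}, (∀ η, #(E η) ≤ Cardinal.lift.{u + 1} κ) ∧
      ∀ β < (succ χ).ord, IsSuccLimit β → κ ≤ β.cof →
        Decomposes κ E (Ico χ.ord (χ.ord * β)) := by
  have hχ : ℵ₀ ≤ χ := hκ.aleph0_le.trans hκχ
  have hθ : χ.ord ≠ 0 := (isSuccLimit_ord hχ).bot_lt.ne'
  have (β : Ordinal.{u}) : ∃ e : Ordinal.{u} → Set Ordinal.{u},
      (∀ ζ, #(e ζ) ≤ Cardinal.lift.{u + 1} κ) ∧ (β < (succ χ).ord →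
        ∀ X ⊆ Iio (χ.ord * β), #X < Cardinal.lift.{u + 1} κ → ∃ ζ < χ.ord, e ζ = X) := by
    by_cases hβ : β < (succ χ).ord
    · obtain ⟨e, he, he'⟩ := exists_enumeration _ (mk_small_subsets_le hGCH hχ hcof
        (mk_Iio_le_of_lt_succ (mul_lt_succ_ord hχ hβ)))
      refine ⟨e, fun ζ ↦ ?_, fun _ X hX hXc ↦ he X ⟨hX, hXc⟩⟩
      rcases he' ζ with h | h
      · exact h.2.le
      · simp [h]
    · exact ⟨fun _ ↦ ∅, by simp, fun h ↦ absurd h hβ⟩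
  choose e he he' using this
  -- Block `γ` lists all small subsets of `χ * γ`. For `β` as in the claim, a small `X` is bounded
  -- below `χ * β`, so it is listed in a nonzero block that lies above `X` and below `χ * β`.
  refine ⟨fun η ↦ e (η / χ.ord) (η % χ.ord), fun η ↦ he _ _, fun β hβ hlim hβcof ↦
    CoverClosed.decomposes hκ fun X hX hXc ↦ ?_⟩
  have hn := isNormal_ord_mul hχ
  rw [← cof_map_of_isNormal hn hlim] at hβcof
  obtain ⟨δ, hδ, hXδ⟩ := exists_bound (fun x hx ↦ (hX hx).2)
    (hXc.trans_le (Cardinal.lift_le.2 hβcof))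
  obtain ⟨γ, hγ, hδγ⟩ := (hn.lt_iff_exists_lt hlim).1 hδ
  have hγ1 : succ γ < β := hlim.succ_lt hγ
  have hXγ : X ⊆ Iio (χ.ord * succ γ) := fun x hx ↦
    (hXδ hx).trans_lt (hδγ.trans (hn.strictMono (lt_succ γ)))
  obtain ⟨ζ, hζ, rfl⟩ := he' (succ γ) (hγ1.trans hβ) X hXγ hXc
  refine ⟨χ.ord * succ γ + ζ, ⟨?_, ?_⟩, fun x hx ↦ ⟨?_, ?_⟩⟩
  · exact (le_mul_of_one_le_right' (Order.one_le_iff_pos.2 (bot_lt_succ γ))).trans le_self_add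
  · calc χ.ord * succ γ + ζ < χ.ord * succ γ + χ.ord := by simpa
      _ = χ.ord * succ (succ γ) := by rw [mul_succ _ (succ γ)]
      _ ≤ _ := hn.strictMono.monotone (succ_le_of_lt hγ1)
  · rwa [mul_add_div _ hθ, div_eq_zero_of_lt hζ, add_zero, mul_add_mod_self, mod_eq_of_lt hζ]
  · exact (mem_Iio.1 (hXγ hx)).le.trans le_self_add

end Steps
end Davies

namespace Davies

open Ordinal Order Set

/-! ### Limits when `cf χ < κ`: use of very weak square -/

section Square

variable {κ χ : Cardinal.{u}}

/-- The increasing enumeration of a club in a regular cardinal, as a normal function. -/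
theorem exists_normal_enumeration {Ω : Cardinal.{u}} (hΩ : Ω.IsRegular) {D : Set Ordinal.{u}}
    (hD : D ⊆ Iio Ω.ord) (hclub : IsClub {a : Iio Ω.ord | (a : Ordinal.{u}) ∈ D}) :
    ∃ d : Ordinal.{u} → Ordinal.{u}, IsNormal d ∧ (∀ β < Ω.ord, d β ∈ D) ∧
      ∀ δ ∈ D, ∃ β, d β = δ := by
  -- Adding all ordinals from `Ω` on makes the club unbounded in the ordinals. Below `Ω` the
  -- enumeration still takes values in `D`, since otherwise `D` would be smaller than `Ω`, hence
  -- bounded.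
  set D' : Set Ordinal.{u} := D ∪ Ici Ω.ord with hD'
  have hunb : ¬ BddAbove D' := fun ⟨b, hb⟩ ↦ by
    have h1 : max (succ b) Ω.ord ∈ D' := Or.inr (mem_Ici.2 (le_max_right _ _))
    exact (lt_succ b).not_ge ((le_max_left _ _).trans (hb h1))
  have hclosed : ∀ t ⊆ D', t.Nonempty → BddAbove t → sSup t ∈ D' := by
    intro t ht htne htb
    rcases lt_or_ge (sSup t) Ω.ord with h | h
    · left
      have hlt : ∀ x ∈ t, x < Ω.ord := fun x hx ↦ (le_csSup htb hx).trans_lt h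
      have htD : ∀ x ∈ t, x ∈ D := fun x hx ↦ (ht hx).resolve_right (hlt x hx).not_ge
      obtain ⟨x0, hx0⟩ := htne
      refine hclub.isLUB_mem (t := {a : Iio Ω.ord | a.1 ∈ t}) (x := ⟨sSup t, h⟩)
        (fun a ha ↦ htD _ ha) ⟨⟨x0, hlt _ hx0⟩, hx0⟩ ⟨fun a ha ↦ le_csSup htb ha, fun b hb ↦ ?_⟩
      exact csSup_le ⟨x0, hx0⟩ fun x hx ↦ @hb ⟨x, hlt x hx⟩ hx
    · exact Or.inr h
  have hn := isNormal_enumOrd hclosed hunb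
  refine ⟨enumOrd D', hn, fun β hβ ↦ ?_, fun δ hδ ↦ enumOrd_surjective hunb (Or.inl hδ)⟩
  refine (enumOrd_mem hunb β).resolve_right fun hge ↦ ?_
  have hsub : D ⊆ enumOrd D' '' Iio β := fun δ hδ ↦ by
    obtain ⟨γ, rfl⟩ := enumOrd_surjective hunb (Or.inl hδ : δ ∈ D')
    exact ⟨γ, hn.strictMono.lt_iff_lt.1 ((hD hδ).trans_le hge), rfl⟩
  have hcard : #D < Cardinal.lift.{u + 1} Ω.ord.cof := by
    refine ((mk_le_mk_of_subset hsub).trans mk_image_le).trans_lt ?_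
    rw [Cardinal.mk_Iio_ordinal, Cardinal.lift_lt, hΩ.cof_ord]
    exact lt_ord.1 hβ
  obtain ⟨b, hb, hDb⟩ := exists_bound hD hcard
  obtain ⟨c, hc, hbc⟩ := hclub.isCofinal ⟨succ b, (isSuccLimit_ord hΩ.aleph0_le).succ_lt hb⟩
  exact (lt_succ b).not_ge ((show succ b ≤ c.1 from hbc).trans (hDb hc))

/-- An increasing exhaustion of every `γ < χ⁺` by sets of size `< χ`. -/
theorem exists_exhaustion (hχ : χ.IsSingular) (hκχ : κ < χ) (hκ : ℵ₀ ≤ κ) :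
    ∃ (L : Iio χ.ord.cof.ord → Cardinal.{u})
      (s : Ordinal.{u} → Iio χ.ord.cof.ord → Set Ordinal.{u}),
      Monotone L ∧ (∀ j, κ ≤ L j ∧ L j < χ ∧ (L j).IsRegular) ∧
      (∀ ζ < χ.ord, ∃ j, ζ < (L j).ord) ∧ (∀ γ, Monotone (s γ)) ∧
      (∀ γ j, s γ j ⊆ Iio γ) ∧ (∀ γ j, #(s γ j) ≤ Cardinal.lift.{u + 1} (L j)) ∧
      ∀ γ < (succ χ).ord, ∀ ξ < γ, ∃ j, ξ ∈ s γ j := by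
  have hχ := hχ.aleph0_le
  have hlim := ‹χ.IsSingular›.isSuccLimit
  obtain ⟨f, hf⟩ := exists_isFundamentalSeq (o := χ.ord) rfl
  have (γ : Ordinal.{u}) : ∃ i : Ordinal.{u} → Ordinal.{u}, γ < (succ χ).ord →
      (∀ ξ < γ, i ξ < χ.ord) ∧ InjOn i (Iio γ) := by
    by_cases hγ : γ < (succ χ).ord
    · have h := mk_Iio_le_of_lt_succ hγ
      rw [← card_ord χ, ← Cardinal.mk_Iio_ordinal] at h
      obtain ⟨g⟩ := h
      classical
      refine ⟨fun ξ ↦ if h : ξ < γ then (g ⟨ξ, h⟩).1 else 0, fun _ ↦ ⟨fun ξ hξ ↦ ?_, ?_⟩⟩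
      · beta_reduce
        rw [dif_pos hξ]; exact (g ⟨ξ, hξ⟩).2
      · intro x hx y hy hxy
        beta_reduce at hxy
        rw [dif_pos (mem_Iio.1 hx), dif_pos (mem_Iio.1 hy)] at hxy
        exact congrArg Subtype.val (g.injective (Subtype.ext hxy))
    · exact ⟨id, fun h ↦ absurd h hγ⟩
  choose i hi using this
  -- The successor makes `L j` regular; it stays below `χ` because a singular cardinal is a limit.
  -- The set `s γ j` will be the preimage of `L j` under an injection of `γ` into `χ`.
  let L : Iio χ.ord.cof.ord → Cardinal.{u} := fun j ↦ succ (max κ (f j).1.card)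
  have hL : Monotone L := fun a b hab ↦ succ_le_succ <| max_le_max le_rfl <|
    card_le_card (hf.strictMono.monotone hab)
  refine ⟨L, fun γ j ↦ {ξ | γ < (succ χ).ord ∧ ξ < γ ∧ i γ ξ < (L j).ord}, hL, fun j ↦ ⟨?_, ?_, ?_⟩,
    fun ζ hζ ↦ ?_, fun γ a b hab ξ hξ ↦ ?_, fun γ j ξ hξ ↦ hξ.2.1, fun γ j ↦ ?_,
    fun γ hγ ξ hξ ↦ ?_⟩
  · exact (le_max_left _ _).trans (le_succ _)
  · exact hlim.succ_lt (max_lt hκχ (lt_ord.1 (f j).2))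
  · exact isRegular_succ (hκ.trans (le_max_left _ _))
  · obtain ⟨_, ⟨j, rfl⟩, hj⟩ := hf.isCofinal_range ⟨ζ, hζ⟩
    refine ⟨j, lt_ord.2 (lt_succ_iff.2 ((Ordinal.card_le_card ?_).trans (le_max_right _ _)))⟩
    exact hj
  · exact ⟨hξ.1, hξ.2.1, hξ.2.2.trans_le (ord_le_ord.2 (hL hab))⟩
  · by_cases hγ : γ < (succ χ).ord
    · have hinj : InjOn (i γ) {ξ | γ < (succ χ).ord ∧ ξ < γ ∧ i γ ξ < (L j).ord} :=
        (hi γ hγ).2.mono fun ξ hξ ↦ hξ.2.1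
      rw [← mk_image_eq_of_injOn _ _ hinj, ← card_ord (L j), ← Cardinal.mk_Iio_ordinal]
      refine mk_le_mk_of_subset ?_
      rintro _ ⟨ξ, hξ, rfl⟩
      simpa using hξ.2.2
    · simp [hγ]
  · obtain ⟨_, ⟨j, rfl⟩, hj⟩ := hf.isCofinal_range ⟨i γ ξ, (hi γ hγ).1 ξ hξ⟩
    refine ⟨j, hγ, hξ, lt_ord.2 (lt_succ_iff.2 ((Ordinal.card_le_card ?_).trans (le_max_right _ _)))⟩
    exact hj

/-- For singular `χ`, very weak square yields a decomposition of `[χ, χ * β)` for all limits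
`β < χ⁺` of cofinality at least `κ`. -/
theorem exists_limit_covering_of_square (hGCH : GCH.{u}) (hκ : κ.IsRegular) (hκχ : κ < χ)
    (hcof : χ.ord.cof < κ) (hsq : VeryWeakSquare χ κ κ) :
    ∃ E : Ordinal.{u} → Set Ordinal.{u}, (∀ η, #(E η) ≤ Cardinal.lift.{u + 1} κ) ∧
      ∀ β < (succ χ).ord, IsSuccLimit β → κ ≤ β.cof →
        Decomposes κ E (Ico χ.ord (χ.ord * β)) := by
  have hχ : ℵ₀ ≤ χ := hκ.aleph0_le.trans hκχ.le
  have hθ : χ.ord ≠ 0 := (isSuccLimit_ord hχ).bot_lt.ne'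
  have hsing : χ.IsSingular := .of_not_isRegular hχ fun h ↦ by
    rw [h.cof_ord] at hcof; exact hcof.not_gt hκχ
  obtain ⟨C, D, hD, hclub, hCD⟩ := hsq
  obtain ⟨d, hd, hdD, hdsurj⟩ := exists_normal_enumeration (isRegular_succ hχ) hD hclub
  obtain ⟨L, s, hL, hL', hLχ, hs, hsγ, hsL, hsun⟩ := exists_exhaustion hsing hκχ hκ.aleph0_le
  have hJ : #(Iio χ.ord.cof.ord) < Cardinal.lift.{u + 1} κ := by
    rwa [Cardinal.mk_Iio_ordinal, card_ord, Cardinal.lift_lt]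
  have hLinf (j) : ℵ₀ ≤ Cardinal.lift.{u + 1} (L j) := by
    rw [aleph0_le_lift]; exact (hL' j).2.2.aleph0_le
  -- A piece of `[χ, χ * γ)` of size at most `L j`: the nonzero blocks with index in `s γ j`, each
  -- cut off at length `L j`.
  let A : Ordinal.{u} → Iio χ.ord.cof.ord → Set Ordinal.{u} := fun γ j ↦
    {η | η / χ.ord ∈ s γ j ∧ 0 < η / χ.ord ∧ η % χ.ord < (L j).ord}
  let B : Ordinal.{u} → Set Ordinal.{u} := fun ξ ↦ d ⁻¹' C ξ
  -- The sets that block `β` must list at level `j`. At most `L j` indices `ξ` are admitted and `L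
  -- j` is regular, so by GCH these sets fit into the first `L j` places of the block.
  let F : Ordinal.{u} → Iio χ.ord.cof.ord → Set (Set Ordinal.{u}) := fun β j ↦
    ⋃ ξ ∈ {ξ ∈ s (d (succ β)) j | #(B ξ) < Cardinal.lift.{u + 1} κ},
      {X | X ⊆ ⋃ γ ∈ B ξ, A γ j ∧ #X < Cardinal.lift.{u + 1} κ}
  have hAmono (γ) : Monotone (A γ) := fun a b hab η hη ↦
    ⟨hs γ hab hη.1, hη.2.1, hη.2.2.trans_le (ord_le_ord.2 (hL hab))⟩
  have hAcard (γ j) : #(A γ j) ≤ Cardinal.lift.{u + 1} (L j) := by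
    have hsub : A γ j ⊆ ⋃ β : s γ j, (χ.ord * β.1 + ·) '' Iio (L j).ord := fun η hη ↦
      mem_iUnion.2 ⟨⟨_, hη.1⟩, _, hη.2.2, div_add_mod η χ.ord⟩
    refine (mk_le_mk_of_subset hsub).trans (mk_iUnion_le_of_le (hLinf j) (hsL γ j) fun β ↦ ?_)
    refine mk_image_le.trans ?_
    rw [Cardinal.mk_Iio_ordinal, card_ord]
  have hFcard (β j) : #(F β j) ≤ Cardinal.lift.{u + 1} (L j) := by
    simp only [F, biUnion_eq_iUnion]
    refine mk_iUnion_le_of_le (hLinf j) ((mk_le_mk_of_subset (sep_subset _ _)).trans (hsL _ j))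
      fun ξ ↦ mk_small_subsets_le hGCH (hL' j).2.2.aleph0_le ?_ ?_
    · rw [(hL' j).2.2.cof_ord]; exact (hL' j).1
    · rw [← biUnion_eq_iUnion (B ξ.1) (fun γ _ ↦ A γ j), biUnion_eq_iUnion]
      exact mk_iUnion_le_of_le (hLinf j) (ξ.2.2.le.trans (Cardinal.lift_le.2 (hL' j).1))
        fun γ ↦ hAcard _ _
  choose e he he' using fun β j ↦ exists_enumeration _ (hFcard β j)
  -- One place serves all levels simultaneously; there are only `cf χ < κ` of them.
  refine ⟨fun η ↦ ⋃ j, e (η / χ.ord) j (η % χ.ord), fun η ↦ ?_, fun β hβ hlim hβcof ↦ ?_⟩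
  · refine mk_iUnion_le_of_le (by simpa using hκ.aleph0_le) hJ.le fun j ↦ ?_
    rcases he' (η / χ.ord) j (η % χ.ord) with h | h
    · simp only [F, mem_iUnion] at h
      obtain ⟨_, _, h⟩ := h
      exact h.2.le
    · simp [h]
  have hdcof : κ ≤ (d β).cof := by rwa [cof_map_of_isNormal hd hlim]
  obtain ⟨⟨hC1, hC2, -⟩, hC3⟩ := hCD (d β) (hdD β hβ) hdcof
  have hBβ : B (d β) ⊆ Iio β := fun γ hγ ↦ hd.strictMono.lt_iff_lt.1 (hC1 hγ).1
  have hBcof : ∀ γ < β, ∃ γ' ∈ B (d β), γ ≤ γ' := fun γ hγ ↦ by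
    obtain ⟨c, hc, hle⟩ := hC2 (d γ) ⟨hd.strictMono hγ, hdD γ (hγ.trans hβ)⟩
    obtain ⟨γ', rfl⟩ := hdsurj c (hC1 hc).2
    exact ⟨γ', hc, hd.strictMono.le_iff_le.1 hle⟩
  let W : Iio χ.ord.cof.ord → Set Ordinal.{u} := fun j ↦ ⋃ γ ∈ B (d β), A γ j
  -- Level `j` handles `Y`: a square set `B ξ` covers `Y`, block `β'` sees `ξ` at level `j` and lies
  -- beyond `Y`, and the block itself meets `W j` because `β' ∈ s γ j`.
  let P : Set Ordinal.{u} → Iio χ.ord.cof.ord → Prop := fun Y j ↦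
    ∃ ξ, ∃ β', ∃ γ ∈ B (d β), 0 < β' ∧ β' ∈ s γ j ∧ ξ ∈ s (d (succ β')) j ∧ Y ⊆ B ξ ∧
      B ξ ⊆ B (d β) ∧ #(B ξ) < Cardinal.lift.{u + 1} κ ∧ Y ⊆ Iic β'
  have hP : ∀ Y ⊆ B (d β), #Y < Cardinal.lift.{u + 1} κ → ∃ j, P Y j := fun Y hY hYc ↦ by
    obtain ⟨ξ, hξ, h1, h2, h3⟩ := hC3 (d '' Y) (image_subset_iff.2 hY) (mk_image_le.trans_lt hYc)
    obtain ⟨β1, hβ1, hξ1⟩ := (hd.lt_iff_exists_lt hlim).1 hξ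
    obtain ⟨β2, hβ2, hY2⟩ := exists_bound (hY.trans hBβ)
      (hYc.trans_le (Cardinal.lift_le.2 hβcof))
    have hβ' : max (succ β1) β2 < β := max_lt (hlim.succ_lt hβ1) hβ2
    obtain ⟨γ, hγ, hγ'⟩ := hBcof _ (hlim.succ_lt hβ')
    obtain ⟨j1, hj1⟩ := hsun γ ((hBβ hγ).trans hβ) _ (succ_le_iff.1 hγ')
    obtain ⟨j2, hj2⟩ := hsun (d (succ (max (succ β1) β2)))
      (hD (hdD _ ((hlim.succ_lt hβ').trans hβ))) ξ (hξ1.trans (hd.strictMono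
        (lt_succ_of_le ((le_succ β1).trans (le_max_left _ _)))))
    refine ⟨max j1 j2, ξ, _, γ, hγ, (bot_lt_succ β1).trans_le (le_max_left _ β2),
      hs γ (le_max_left _ _) hj1, hs _ (le_max_right _ _) hj2, image_subset_iff.1 h1,
      preimage_mono h2, ?_, hY2.trans (Iic_subset_Iic.2 (le_max_right _ _))⟩
    rw [← mk_image_eq hd.strictMono.injective]
    exact (mk_le_mk_of_subset (image_preimage_subset _ _)).trans_lt h3
  have hPY {Y Y' j} (h : P Y j) (hY : Y' ⊆ Y) : P Y' j := by
    obtain ⟨ξ, β', γ, h1, h2, h3, h4, h5, h6, h7, h8⟩ := h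
    exact ⟨ξ, β', γ, h1, h2, h3, h4, hY.trans h5, h6, h7, hY.trans h8⟩
  have hPj {Y j j'} (h : P Y j) (hj : j ≤ j') : P Y j' := by
    obtain ⟨ξ, β', γ, h1, h2, h3, h4, h5⟩ := h
    exact ⟨ξ, β', γ, h1, h2, hs _ hj h3, hs _ hj h4, h5⟩
  -- Were there a bad `Y j` for each of the fewer than `κ` levels, their union would still be small;
  -- a level handling it would handle its own bad set.
  obtain ⟨j0, hj0⟩ : ∃ j, ∀ Y ⊆ B (d β), #Y < Cardinal.lift.{u + 1} κ → P Y j := by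
    by_contra! hcon
    choose Y hY1 hY2 hY3 using hcon
    obtain ⟨j, hj⟩ := hP (⋃ j, Y j) (iUnion_subset hY1)
      ((card_iUnion_lt_iff_forall_of_isRegular hκ.lift hJ).2 hY2)
    exact hY3 j (hPY hj (subset_iUnion Y j))
  have hWcl : ∀ j, j0 ≤ j → CoverClosed κ (fun η ↦ ⋃ j, e (η / χ.ord) j (η % χ.ord)) (W j) := by
    -- Pick for each `x ∈ X` some `γ` with `x ∈ A γ j` and apply `P` to the set of these `γ`. Then
    -- `X ∈ F β' j`, so `X` sits at a place `ζ < L j`, and the index `χ * β' + ζ` belongs to `W j`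
    -- and exceeds `X`.
    intro j hj X hX hXc
    have hX' : ∀ x : X, ∃ γ, γ ∈ B (d β) ∧ x.1 ∈ A γ j := fun x ↦ by
      simpa [W] using hX x.2
    choose g hg1 hg2 using hX'
    obtain ⟨ξ, β', γ, h1, h2, h3, h4, h5, h6, h7, h8⟩ := hPj (hj0 (range g)
      (range_subset_iff.2 hg1) (mk_range_le.trans_lt hXc)) hj
    have hXF : X ∈ F β' j := by
      simp only [F, mem_iUnion]
      refine ⟨ξ, ⟨h4, h7⟩, fun x hx ↦ ?_, hXc⟩
      exact mem_iUnion₂.2 ⟨g ⟨x, hx⟩, h5 (mem_range_self _), hg2 ⟨x, hx⟩⟩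
    obtain ⟨ζ, hζ, hζX⟩ := he β' j X hXF
    have hζχ : ζ < χ.ord := hζ.trans (ord_lt_ord.2 (hL' j).2.1)
    have hdiv : (χ.ord * β' + ζ) / χ.ord = β' := by
      rw [mul_add_div _ hθ, div_eq_zero_of_lt hζχ, add_zero]
    have hmod : (χ.ord * β' + ζ) % χ.ord = ζ := by
      rw [mul_add_mod_self, mod_eq_of_lt hζχ]
    refine ⟨χ.ord * β' + ζ, mem_iUnion₂.2 ⟨γ, h1, ?_⟩, fun x hx ↦ ⟨?_, ?_⟩⟩
    · exact ⟨by rwa [hdiv], by rwa [hdiv], by rwa [hmod]⟩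
    · beta_reduce
      rw [hdiv, hmod]
      exact mem_iUnion.2 ⟨j, hζX ▸ hx⟩
    · have h9 : x / χ.ord < β' := (hsγ _ _ (hg2 ⟨x, hx⟩).1).trans_le (h8 (mem_range_self _))
      exact (((lt_mul_iff_div_lt hθ).2 h9).le).trans le_self_add
  refine ⟨W '' Ici j0, (mk_image_le.trans (mk_set_le _)).trans_lt hJ, ?_, ?_⟩
  · ext η
    simp only [W, sUnion_image, mem_iUnion, mem_Ico]
    constructor
    · rintro ⟨j, -, γ, hγ, h1, h2, -⟩
      exact ⟨(Ordinal.div_pos hθ).1 h2, (lt_mul_iff_div_lt hθ).2 ((hsγ _ _ h1).trans (hBβ hγ))⟩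
    · rintro ⟨h1, h2⟩
      have h3 : η / χ.ord < β := (lt_mul_iff_div_lt hθ).1 h2
      obtain ⟨γ, hγ, hγ'⟩ := hBcof _ (hlim.succ_lt h3)
      obtain ⟨j1, hj1⟩ := hsun γ ((hBβ hγ).trans hβ) _ (succ_le_iff.1 hγ')
      obtain ⟨j2, hj2⟩ := hLχ _ (mod_lt η hθ)
      refine ⟨max j0 (max j1 j2), mem_Ici.2 (le_max_left _ _), γ, hγ, ?_, (Ordinal.div_pos hθ).2 h1, ?_⟩
      · exact hs γ ((le_max_left _ _).trans (le_max_right _ _)) hj1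
      · exact hj2.trans_le (ord_le_ord.2 (hL ((le_max_right _ _).trans (le_max_right _ _))))
  · rintro _ ⟨j, hj, rfl⟩
    exact hWcl j hj

end Square

/-! ### Assembling the coverings by induction on `χ` -/

section Covering

variable {κ χ : Cardinal.{u}}

/-- Induction on `β` decomposes `[χ, χ * β)`: successors append a block, limits of small cofinality
are short unions, and the other limits are `hR`. A general `α` adds an initial part of one block. -/
theorem isCovering_of_parts (hκ : κ.IsRegular) (hχ : ℵ₀ ≤ χ) {E : Ordinal.{u} → Set Ordinal.{u}}
    (hT : ∀ β, ∀ r ≤ χ.ord, Decomposes κ E (Ico (χ.ord * β) (χ.ord * β + r)))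
    (hU : ∀ X ⊆ Iio (succ χ).ord, #X < Cardinal.lift.{u + 1} κ →
      ∃ η ∈ Ico χ.ord (succ χ).ord, X ⊆ E η ∩ Iic η)
    (hR : ∀ β < (succ χ).ord, IsSuccLimit β → κ ≤ β.cof →
      Decomposes κ E (Ico χ.ord (χ.ord * β))) : IsCovering κ χ E := by
  have hθ : χ.ord ≠ 0 := (isSuccLimit_ord hχ).bot_lt.ne'
  have hn := isNormal_ord_mul hχ
  have key : ∀ β < (succ χ).ord, Decomposes κ E (Ico χ.ord (χ.ord * β)) := by
    intro β
    induction β using WellFoundedLT.induction with | ind β ih =>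
    intro hβ
    rcases zero_or_succ_or_isSuccLimit β with rfl | ⟨γ, rfl⟩ | hlim
    · simpa using decomposes_empty hκ
    · rcases eq_or_ne γ 0 with rfl | hγ
      · simpa using decomposes_empty hκ
      · have h := (ih γ (lt_succ γ) ((lt_succ γ).trans hβ)).union hκ (hT γ χ.ord le_rfl)
        rwa [Ico_union_Ico_eq_Ico (le_mul_of_one_le_right' (Order.one_le_iff_ne_zero.2 hγ))
          le_self_add, ← mul_succ] at h
    · by_cases hcof : κ ≤ β.cof
      · exact hR β hβ hlim hcof
      · exact Decomposes.of_cof_lt hκ hn hlim (not_le.1 hcof) fun γ hγ ↦ ih γ hγ (hγ.trans hβ)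
  refine ⟨hU, fun α hα ↦ ?_⟩
  rcases lt_or_ge α χ.ord with h | h
  · rw [Ico_eq_empty h.not_gt]; exact decomposes_empty hκ
  · have h1 : α / χ.ord < (succ χ).ord :=
      (div_le_of_le_mul (le_mul_of_one_le_left' (Order.one_le_iff_ne_zero.2 hθ))).trans_lt hα
    have h2 := (key _ h1).union hκ (hT (α / χ.ord) (α % χ.ord) (mod_lt _ hθ).le)
    rwa [Ico_union_Ico_eq_Ico _ le_self_add, div_add_mod] at h2
    exact le_mul_of_one_le_right' (Order.one_le_iff_pos.2 ((Ordinal.div_pos hθ).2 h))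

/-- For `E = Iic` an interval is cover-closed if it has a maximum or if its endpoint has cofinality
at least `κ`; for smaller cofinality it is a union of few closed intervals. -/
theorem isCovering_Iic (hκ : κ.IsRegular) : IsCovering κ κ Iic where
  cover X hX hXc := by
    obtain ⟨β, hβ, hXβ⟩ := exists_bound hX (hXc.trans_le (Cardinal.lift_le.2 (by
      rw [(isRegular_succ hκ.aleph0_le).cof_ord]; exact le_succ κ)))
    refine ⟨max κ.ord β, ⟨le_max_left _ _, max_lt (ord_lt_ord.2 (lt_succ κ)) hβ⟩, ?_⟩
    rw [inter_self]
    exact hXβ.trans (Iic_subset_Iic.2 (le_max_right _ _))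
  decomposes α hα := by
    have hIcc (β : Ordinal.{u}) : Decomposes κ Iic (Icc κ.ord β) := by
      rcases lt_or_ge β κ.ord with h | h
      · rw [Icc_eq_empty h.not_ge]; exact decomposes_empty hκ
      · refine CoverClosed.decomposes hκ fun X hX _ ↦ ⟨β, ⟨h, le_rfl⟩, ?_⟩
        exact fun x hx ↦ ⟨(hX hx).2, (hX hx).2⟩
    rcases le_or_gt α κ.ord with hα' | hα'
    · rw [Ico_eq_empty hα'.not_gt]; exact decomposes_empty hκ
    rcases le_or_gt κ α.cof with hcof | hcof
    · refine CoverClosed.decomposes hκ fun X hX hXc ↦ ?_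
      obtain ⟨β, hβ, hXβ⟩ := exists_bound (fun x hx ↦ (hX hx).2)
        (hXc.trans_le (Cardinal.lift_le.2 hcof))
      refine ⟨max κ.ord β, ⟨le_max_left _ _, max_lt hα' hβ⟩, ?_⟩
      rw [inter_self]
      exact hXβ.trans (Iic_subset_Iic.2 (le_max_right _ _))
    · obtain ⟨g, hg⟩ := exists_isFundamentalSeq (o := α) rfl
      have h := Decomposes.iUnion (E := Iic) hκ (ι := Iio α.cof.ord) (by
        rwa [Cardinal.mk_Iio_ordinal, card_ord, Cardinal.lift_lt]) fun i ↦ hIcc (g i)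
      convert h using 1
      ext x
      simp only [mem_iUnion, mem_Ico, mem_Icc]
      constructor
      · rintro ⟨h1, h2⟩
        obtain ⟨_, ⟨i, rfl⟩, hi⟩ := hg.isCofinal_range ⟨x, h2⟩
        exact ⟨i, h1, hi⟩
      · rintro ⟨i, h1, h2⟩
        exact ⟨h1, h2.trans_lt (g i).2⟩

theorem mk_Iic_le_of_lt_succ (hκ : κ.IsRegular) {η : Ordinal.{u}} (h : η < (succ κ).ord) :
    #(Iic η) ≤ Cardinal.lift.{u + 1} κ := by
  rw [← Iio_succ]
  exact mk_Iio_le_of_lt_succ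
    ((isSuccLimit_ord (hκ.aleph0_le.trans (le_succ κ))).succ_lt h)

theorem exists_covering (hGCH : GCH.{u}) (hVWS : VWS.{u}) (hκ : κ.IsRegular) (hκχ : κ ≤ χ) :
    ∃ E : Ordinal.{u} → Set Ordinal.{u}, (∀ η, #(E η) ≤ Cardinal.lift.{u + 1} κ) ∧
      IsCovering κ χ E := by
  induction χ using WellFoundedLT.induction with | ind χ ih =>
  rcases hκχ.eq_or_lt with rfl | hlt
  · classical
    refine ⟨fun η ↦ if η < (succ κ).ord then Iic η else ∅, fun η ↦ ?_,
      (isCovering_Iic hκ).congr fun η hη ↦ by simp [hη.2]⟩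
    beta_reduce
    split_ifs with h
    · exact mk_Iic_le_of_lt_succ hκ h
    · simp
  have hχ : ℵ₀ ≤ χ := hκ.aleph0_le.trans hκχ
  classical
  choose! G hG1 hG2 using ih
  -- The coverings below `χ` are pasted: `η` uses the one for the cardinal `|η|`.
  let F : Ordinal.{u} → Set Ordinal.{u} := fun η ↦
    if η < κ.ord then Iic η else if η < χ.ord then G η.card η else ∅
  have hF : ∀ η, #(F η) ≤ Cardinal.lift.{u + 1} κ := fun η ↦ by
    simp only [F]
    split_ifs with h1 h2
    · exact mk_Iic_le_of_lt_succ hκ (h1.trans (ord_lt_ord.2 (lt_succ κ)))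
    · exact hG1 _ (lt_ord.1 h2) (by simpa using Ordinal.card_le_card (not_lt.1 h1)) η
    · simp
  have hFdec := decomposes_Iio (E := F) (lam := χ) hκ (fun η hη ↦ by simp [F, hη])
    fun χ' h1 h2 ↦ (hG2 χ' h2 h1).congr fun η hη ↦ by
      have h3 : η.card = χ' := le_antisymm (lt_succ_iff.1 (lt_ord.1 hη.2))
        (by simpa using Ordinal.card_le_card hη.1)
      have h4 : ¬ η < κ.ord := ((ord_le_ord.2 h1).trans hη.1).not_gt
      have h5 : η < χ.ord := lt_ord.2 (h3 ▸ h2)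
      simp [F, h4, h5, h3]
  obtain ⟨T, hT1, hT2⟩ := exists_translate_covering χ.ord hF hFdec
  obtain ⟨U, hU1, hU2⟩ := exists_unbounded_cover hGCH hκ hκχ
  obtain ⟨R, hR1, hR2⟩ : ∃ E : Ordinal.{u} → Set Ordinal.{u},
      (∀ η, #(E η) ≤ Cardinal.lift.{u + 1} κ) ∧ ∀ β < (succ χ).ord, IsSuccLimit β → κ ≤ β.cof →
        Decomposes κ E (Ico χ.ord (χ.ord * β)) := by
    by_cases hcof : κ ≤ χ.ord.cof
    · exact exists_limit_covering_of_le_cof hGCH hκ hκχ hcof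
    · exact exists_limit_covering_of_square hGCH hκ hlt (not_le.1 hcof)
        (hVWS χ κ κ hχ hκ hκ le_rfl hκχ)
  have hinf : ℵ₀ ≤ Cardinal.lift.{u + 1} κ := by simpa using hκ.aleph0_le
  refine ⟨fun η ↦ T η ∪ (U η ∪ R η), fun η ↦ ?_, isCovering_of_parts hκ hχ ?_ ?_ ?_⟩
  · exact (mk_union_le _ _).trans (add_le_of_le hinf (hT1 η)
      ((mk_union_le _ _).trans (add_le_of_le hinf (hU1 η) (hR1 η))))
  · exact fun β r hr ↦ (hT2 β r hr).congr fun η _ ↦ subset_union_left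
  · intro X hX hXc
    obtain ⟨η, hη, h⟩ := hU2 X hX hXc
    exact ⟨η, hη, fun x hx ↦ ⟨Or.inr (Or.inl (h hx).1), (h hx).2⟩⟩
  · exact fun β hβ hlim hc ↦ (hR2 β hβ hlim hc).congr fun η _ ↦
      subset_union_right.trans subset_union_right

end Covering
end Davies

namespace Davies

open FirstOrder

/-! ### Definability over a class of sets and elementary submodels -/

section Definability

variable {N : Set ZFSet.{u}} {α : Type}

/-- `P` is definable without parameters in the structure `(N, ∈)`. -/
class Dfn (P : (α → N) → Prop) : Prop where
  exists_formula : ∃ φ : setLanguage.Formula α, ∀ v : α → N, φ.Realize v ↔ P v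

/-- `f` is one of the coordinate projections. -/
class IsVar (f : (α → N) → N) : Prop where
  exists_index : ∃ i, ∀ v, f v = v i

instance IsVar.apply (i : α) : IsVar (fun v : α → N ↦ v i) := ⟨i, fun _ ↦ rfl⟩

/-- A quantifier adjoins one variable, so the old ones are then read through `Sum.inl`; this and the
next two instances cover one to three nested quantifiers. -/
instance IsVar.comp_inl (f : (α → N) → N) [h : IsVar f] :
    IsVar (fun w : α ⊕ Unit → N ↦ f (fun i ↦ w (Sum.inl i))) := by
  obtain ⟨i, hi⟩ := h
  exact ⟨Sum.inl i, fun w ↦ hi _⟩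

instance IsVar.comp_inl₂ (f : (α → N) → N) [h : IsVar f] :
    IsVar (fun w : (α ⊕ Unit) ⊕ Unit → N ↦ f (fun i ↦ w (Sum.inl (Sum.inl i)))) := by
  obtain ⟨i, hi⟩ := h
  exact ⟨Sum.inl (Sum.inl i), fun w ↦ hi _⟩

instance IsVar.comp_inl₃ (f : (α → N) → N) [h : IsVar f] :
    IsVar (fun w : ((α ⊕ Unit) ⊕ Unit) ⊕ Unit → N ↦
      f (fun i ↦ w (Sum.inl (Sum.inl (Sum.inl i))))) := by
  obtain ⟨i, hi⟩ := h
  exact ⟨Sum.inl (Sum.inl (Sum.inl i)), fun w ↦ hi _⟩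

theorem Dfn.congr {P Q : (α → N) → Prop} (h : Dfn P) (hPQ : ∀ v, P v ↔ Q v) : Dfn Q := by
  obtain ⟨φ, hφ⟩ := h
  exact ⟨φ, fun v ↦ (hφ v).trans (hPQ v)⟩

instance Dfn.mem (f g : (α → N) → N) [hf : IsVar f] [hg : IsVar g] :
    Dfn (fun v : α → N ↦ (f v : ZFSet) ∈ (g v : ZFSet)) := by
  obtain ⟨i, hi⟩ := hf
  obtain ⟨j, hj⟩ := hg
  refine ⟨Language.Relations.formula₂ (show setLanguage.Relations 2 from MemRel.mem)
    (.var i) (.var j), fun v ↦ ?_⟩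
  rw [hi, hj]
  exact Language.Formula.realize_rel₂

instance Dfn.eq (f g : (α → N) → N) [hf : IsVar f] [hg : IsVar g] :
    Dfn (fun v : α → N ↦ f v = g v) := by
  obtain ⟨i, hi⟩ := hf
  obtain ⟨j, hj⟩ := hg
  refine ⟨Language.Term.equal (.var i) (.var j), fun v ↦ ?_⟩
  rw [Language.Formula.realize_equal, hi, hj]
  rfl

instance Dfn.not (P : (α → N) → Prop) [hP : Dfn P] : Dfn (fun v ↦ ¬ P v) := by
  obtain ⟨φ, hφ⟩ := hP
  exact ⟨φ.not, fun v ↦ by rw [Language.Formula.realize_not, hφ]⟩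

instance Dfn.imp (P Q : (α → N) → Prop) [hP : Dfn P] [hQ : Dfn Q] : Dfn (fun v ↦ P v → Q v) := by
  obtain ⟨φ, hφ⟩ := hP
  obtain ⟨ψ, hψ⟩ := hQ
  exact ⟨φ.imp ψ, fun v ↦ by rw [Language.Formula.realize_imp, hφ, hψ]⟩

instance Dfn.and (P Q : (α → N) → Prop) [Dfn P] [Dfn Q] : Dfn (fun v ↦ P v ∧ Q v) :=
  Dfn.congr (inferInstance : Dfn (fun v ↦ ¬ (P v → ¬ Q v))) fun v ↦ by tauto

instance Dfn.or (P Q : (α → N) → Prop) [Dfn P] [Dfn Q] : Dfn (fun v ↦ P v ∨ Q v) :=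
  Dfn.congr (inferInstance : Dfn (fun v ↦ ¬ P v → Q v)) fun v ↦ by tauto

instance Dfn.iff (P Q : (α → N) → Prop) [Dfn P] [Dfn Q] : Dfn (fun v ↦ (P v ↔ Q v)) :=
  Dfn.congr (inferInstance : Dfn (fun v ↦ (P v → Q v) ∧ (Q v → P v))) fun v ↦ by tauto

instance Dfn.ex (P : (α → N) → N → Prop)
    [hP : Dfn (fun w : α ⊕ Unit → N ↦ P (fun i ↦ w (Sum.inl i)) (w (Sum.inr ())))] :
    Dfn (fun v ↦ ∃ x, P v x) := by
  obtain ⟨φ, hφ⟩ := hP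
  refine ⟨φ.iExs Unit, fun v ↦ ?_⟩
  rw [Language.Formula.realize_iExs]
  simp only [hφ, Sum.elim_inl, Sum.elim_inr]
  exact ⟨fun ⟨i, hi⟩ ↦ ⟨_, hi⟩, fun ⟨x, hx⟩ ↦ ⟨fun _ ↦ x, hx⟩⟩

instance Dfn.all (P : (α → N) → N → Prop)
    [Dfn (fun w : α ⊕ Unit → N ↦ P (fun i ↦ w (Sum.inl i)) (w (Sum.inr ())))] :
    Dfn (fun v ↦ ∀ x, P v x) :=
  Dfn.congr (inferInstance : Dfn (fun v ↦ ¬ ∃ x, ¬ P v x)) fun v ↦ by simp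

theorem IsElementarySubmodel.subset {M : Set ZFSet.{u}} (h : IsElementarySubmodel M N) :
    M ⊆ N := fun x hx ↦ by
  obtain ⟨j, hj⟩ := h
  have h := (j ⟨x, hx⟩).2
  rwa [hj] at h

/-- Elementary submodels contain witnesses for definable existential statements about their
elements. -/
theorem IsElementarySubmodel.exists_mem {M : Set ZFSet.{u}} (h : IsElementarySubmodel M N)
    (P : (α → N) → N → Prop)
    [hP : Dfn (fun w : α ⊕ Unit → N ↦ P (fun i ↦ w (Sum.inl i)) (w (Sum.inr ())))]
    (v : α → N) (hv : ∀ i, (v i).1 ∈ M) (hex : ∃ x, P v x) : ∃ x, x.1 ∈ M ∧ P v x := by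
  obtain ⟨φ, hφ⟩ := hP
  obtain ⟨j, hj⟩ := h
  have hjv : j ∘ (fun i ↦ (⟨v i, hv i⟩ : M)) = v := funext fun i ↦ Subtype.ext (hj _)
  have h1 : (φ.iExs Unit).Realize v := by
    rw [Language.Formula.realize_iExs]
    obtain ⟨x, hx⟩ := hex
    exact ⟨fun _ ↦ x, (hφ _).2 hx⟩
  rw [← hjv, j.map_formula, Language.Formula.realize_iExs] at h1
  obtain ⟨i, hi⟩ := h1
  rw [← j.map_formula, hφ] at hi
  have h3 : P (fun i ↦ v i) (j (i ())) := by
    have : (fun k ↦ (j ∘ Sum.elim (fun k ↦ (⟨v k, hv k⟩ : M)) i) (Sum.inl k)) = v := hjv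
    rw [this] at hi
    exact hi
  exact ⟨j (i ()), by rw [hj]; exact (i ()).2, h3⟩

theorem IsElementarySubmodel.mem_of_unique {M : Set ZFSet.{u}} (h : IsElementarySubmodel M N)
    (P : (α → N) → N → Prop)
    [hP : Dfn (fun w : α ⊕ Unit → N ↦ P (fun i ↦ w (Sum.inl i)) (w (Sum.inr ())))]
    (v : α → N) (hv : ∀ i, (v i).1 ∈ M) (x : N) (hx : P v x) (huniq : ∀ y, P v y → y = x) :
    x.1 ∈ M := by
  obtain ⟨y, hy, hPy⟩ := h.exists_mem P v hv ⟨x, hx⟩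
  rwa [← huniq y hPy]

/-- The **Tarski-Vaught test** for classes of sets. -/
theorem isElementarySubmodel_of_exists {M : Set ZFSet.{u}} (hMN : M ⊆ N)
    (h : ∀ (n : ℕ) (φ : setLanguage.Formula (Fin n ⊕ Unit)) (v : Fin n → N),
      (∀ i, (v i).1 ∈ M) → ∀ x : N, φ.Realize (Sum.elim v fun _ ↦ x) →
        ∃ y : N, y.1 ∈ M ∧ φ.Realize (Sum.elim v fun _ ↦ y)) :
    IsElementarySubmodel M N := by
  let f : setLanguage.Embedding M N :=
    { toFun := fun x ↦ ⟨x.1, hMN x.2⟩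
      inj' := fun x y hxy ↦ Subtype.ext (congrArg Subtype.val hxy :)
      map_fun' := fun f ↦ nomatch f
      map_rel' := fun r x ↦ by cases r; rfl }
  refine ⟨f.toElementaryEmbedding fun n φ x a ha ↦ ?_, fun x ↦ rfl⟩
  let g : Empty ⊕ Fin (n + 1) → Fin n ⊕ Unit :=
    Sum.elim (fun e ↦ nomatch e) (Fin.lastCases (Sum.inr ()) Sum.inl)
  have key (y : N) : (φ.toFormula.relabel g).Realize (Sum.elim (f ∘ x) fun _ ↦ y) ↔
      φ.Realize default (Fin.snoc (f ∘ x) y : Fin (n + 1) → N) := by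
    rw [Language.Formula.realize_relabel, Language.BoundedFormula.realize_toFormula]
    congr! 1
    funext k
    refine Fin.lastCases ?_ (fun k ↦ ?_) k <;> simp [g]
  obtain ⟨y, hy, hφ⟩ := h n _ (f ∘ x) (fun i ↦ (x i).2) a ((key a).2 ha)
  exact ⟨⟨y, hy⟩, (key y).1 hφ⟩

/-- The union of a directed family of elementary submodels is an elementary submodel. -/
theorem isElementarySubmodel_iUnion {ι : Type v} [Nonempty ι] {M : ι → Set ZFSet.{u}}
    (hdir : Directed (· ⊆ ·) M) (h : ∀ i, IsElementarySubmodel (M i) N) :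
    IsElementarySubmodel (⋃ i, M i) N := by
  refine isElementarySubmodel_of_exists (Set.iUnion_subset fun i ↦ (h i).subset) ?_
  intro n φ v hv x hx
  have : ∃ i, ∀ k, (v k).1 ∈ M i := by
    choose k hk using fun i ↦ Set.mem_iUnion.1 (hv i)
    obtain ⟨z, hz⟩ := hdir.finite_le k
    exact ⟨z, fun i ↦ hz i (hk i)⟩
  obtain ⟨i, hi⟩ := this
  have hP : Dfn (fun w : Fin n ⊕ Unit → N ↦
      (fun v x ↦ φ.Realize (Sum.elim v fun _ ↦ x)) (fun i ↦ w (Sum.inl i)) (w (Sum.inr ()))) :=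
    ⟨φ, fun w ↦ by
      congr! 1
      funext k
      rcases k with k | k <;> rfl⟩
  obtain ⟨y, hy, hφ⟩ := (h i).exists_mem (fun v x ↦ φ.Realize (Sum.elim v fun _ ↦ x)) v hi ⟨x, hx⟩
  exact ⟨y, Set.mem_iUnion.2 ⟨i, hy⟩, hφ⟩

end Definability
end Davies

namespace Davies

open ZFSet

/-! ### Closure properties of `H θ` -/

section Hereditary

variable {θ : Cardinal.{u}} {x y a b : ZFSet.{u}}

theorem mem_H_iff : x ∈ H θ ↔ x.card < θ ∧ ∀ y ∈ x, y ∈ H θ :=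
  ZFSet.hereditarily_iff

theorem card_lt_of_mem_H (hx : x ∈ H θ) : x.card < θ := (mem_H_iff.1 hx).1

theorem mem_H_of_mem (hy : y ∈ x) (hx : x ∈ H θ) : y ∈ H θ := (mem_H_iff.1 hx).2 y hy

theorem mem_H_of_subset (hxy : x ⊆ y) (hy : y ∈ H θ) : x ∈ H θ :=
  mem_H_iff.2 ⟨(card_mono hxy).trans_lt (card_lt_of_mem_H hy), fun _ hz ↦ mem_H_of_mem (hxy hz) hy⟩

theorem card_range_le {ι : Type (u + 1)} [Small.{u} ι] {c : Cardinal.{u}} (f : ι → ZFSet.{u})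
    (h : #ι ≤ Cardinal.lift.{u + 1} c) : (ZFSet.range f).card ≤ c := by
  have := (lift_card_range_le (f := f)).trans (Cardinal.lift_le.2 h)
  simpa using this

theorem range_mem_H {ι : Type (u + 1)} [Small.{u} ι] {f : ι → ZFSet.{u}}
    (hι : #ι < Cardinal.lift.{u + 1} θ) (hf : ∀ i, f i ∈ H θ) : ZFSet.range f ∈ H θ := by
  refine mem_H_iff.2 ⟨?_, by simpa⟩
  obtain ⟨c, hc⟩ := Cardinal.mem_range_lift_of_le hι.le
  rw [← hc, Cardinal.lift_lt] at hι
  exact (card_range_le f hc.ge).trans_lt hι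

theorem insert_mem_H (hθ : ℵ₀ ≤ θ) (hx : x ∈ H θ) (hy : y ∈ H θ) : insert x y ∈ H θ := by
  refine mem_H_iff.2 ⟨card_insert_le.trans_lt (add_lt_of_lt hθ (card_lt_of_mem_H hy)
    (one_lt_aleph0.trans_le hθ)), fun z hz ↦ ?_⟩
  rcases mem_insert_iff.1 hz with rfl | hz
  · exact hx
  · exact mem_H_of_mem hz hy

theorem empty_mem_H (hθ : ℵ₀ ≤ θ) : (∅ : ZFSet.{u}) ∈ H θ :=
  mem_H_iff.2 ⟨by simpa using aleph0_pos.trans_le hθ, by simp⟩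

theorem singleton_mem_H (hθ : ℵ₀ ≤ θ) (hx : x ∈ H θ) : ({x} : ZFSet.{u}) ∈ H θ := by
  rw [← insert_empty_eq]; exact insert_mem_H hθ hx (empty_mem_H hθ)

theorem pair_mem_H (hθ : ℵ₀ ≤ θ) (hx : x ∈ H θ) (hy : y ∈ H θ) : pair x y ∈ H θ :=
  insert_mem_H hθ (singleton_mem_H hθ hx) <| singleton_mem_H hθ <|
    insert_mem_H hθ hx (singleton_mem_H hθ hy)

theorem mem_H_of_pair_mem (h : pair a b ∈ x) (hx : x ∈ H θ) : a ∈ H θ ∧ b ∈ H θ := by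
  have h1 : ({a, b} : ZFSet.{u}) ∈ H θ :=
    mem_H_of_mem (by simp [pair]) (mem_H_of_mem h hx)
  exact ⟨mem_H_of_mem (by simp) h1, mem_H_of_mem (by simp) h1⟩

theorem toZFSet_mem_H {o : Ordinal.{u}} (ho : o < θ.ord) : o.toZFSet ∈ H θ := by
  induction o using WellFoundedLT.induction with | ind o ih =>
  refine mem_H_iff.2 ⟨by simpa using Cardinal.lt_ord.1 ho, fun y hy ↦ ?_⟩
  obtain ⟨a, ha, rfl⟩ := Ordinal.mem_toZFSet_iff.1 hy
  exact ih a ha (ha.trans ho)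

theorem card_ord_toZFSet_mem_H (hx : x ∈ H θ) : x.card.ord.toZFSet ∈ H θ :=
  toZFSet_mem_H (Cardinal.ord_lt_ord.2 (card_lt_of_mem_H hx))

theorem exists_mem_H (x : ZFSet.{u}) : ∃ θ₀ : Cardinal.{u}, ∀ θ, θ₀ ≤ θ → x ∈ H θ := by
  induction x using ZFSet.inductionOn with | h x ih =>
  choose f hf using ih
  refine ⟨max (Order.succ x.card) (⨆ y : x, f y.1 y.2), fun θ hθ ↦ mem_H_iff.2 ⟨?_, fun y hy ↦ ?_⟩⟩
  · exact (Order.lt_succ _).trans_le ((le_max_left _ _).trans hθ)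
  · exact hf y hy θ ((le_ciSup (f := fun y : x ↦ f y.1 y.2) bddAbove_of_small ⟨y, hy⟩).trans
      ((le_max_right _ _).trans hθ))

theorem pair_mem_initialSeq {f : Ordinal.{u} → ZFSet.{u}} {α : Ordinal.{u}} :
    pair a b ∈ initialSeq f α ↔ ∃ ξ < α, a = ξ.toZFSet ∧ b = f ξ := by
  simp only [initialSeq, ZFSet.mem_range, pair_inj, Subtype.exists, Set.mem_Iio, exists_prop]
  exact ⟨fun ⟨ξ, h1, h2, h3⟩ ↦ ⟨ξ, h1, h2.symm, h3.symm⟩,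
    fun ⟨ξ, h1, h2, h3⟩ ↦ ⟨ξ, h1, h2.symm, h3.symm⟩⟩

theorem initialSeq_mem_funs {f : Ordinal.{u} → ZFSet.{u}} {α : Ordinal.{u}}
    (h : ∀ ξ < α, f ξ ∈ x) : initialSeq f α ∈ funs α.toZFSet x := by
  refine mem_funs.2 ⟨fun z hz ↦ ?_, fun z hz ↦ ?_⟩
  · obtain ⟨ξ, rfl⟩ := ZFSet.mem_range.1 hz
    exact pair_mem_prod.2 ⟨Ordinal.toZFSet_mem_toZFSet_iff.2 ξ.2, h _ ξ.2⟩
  · obtain ⟨ξ, hξ, rfl⟩ := Ordinal.mem_toZFSet_iff.1 hz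
    refine ⟨f ξ, pair_mem_initialSeq.2 ⟨ξ, hξ, rfl, rfl⟩, fun y hy ↦ ?_⟩
    obtain ⟨ξ', -, h1, rfl⟩ := pair_mem_initialSeq.1 hy
    rw [Ordinal.toZFSet_injective h1]

theorem initialSeq_mem_H (hθ : ℵ₀ ≤ θ) {f : Ordinal.{u} → ZFSet.{u}} {α : Ordinal.{u}}
    (hα : α < θ.ord) (h : ∀ ξ < α, f ξ ∈ H θ) : initialSeq f α ∈ H θ := by
  refine range_mem_H ?_ fun ξ ↦ pair_mem_H hθ (toZFSet_mem_H (ξ.2.trans hα)) (h _ ξ.2)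
  rw [Cardinal.mk_Iio_ordinal, Cardinal.lift_lt]
  exact Cardinal.lt_ord.1 hα

end Hereditary

/-! ### Notions definable over `H θ` -/

section DefinableNotions

variable {θ : Cardinal.{u}} {α : Type}

/-- As `H θ` is transitive, bounded quantifiers mean the same inside it. -/
instance Dfn.exists_mem (f : (α → H θ) → H θ) [IsVar f] (P : (α → H θ) → ZFSet.{u} → Prop)
    [Dfn (fun w : α ⊕ Unit → H θ ↦ P (fun i ↦ w (Sum.inl i)) (w (Sum.inr ())).1)] :
    Dfn (fun v ↦ ∃ x ∈ (f v).1, P v x) :=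
  Dfn.congr (inferInstance : Dfn (fun v ↦ ∃ x : H θ, x.1 ∈ (f v).1 ∧ P v x.1)) fun v ↦
    ⟨fun ⟨x, h1, h2⟩ ↦ ⟨x.1, h1, h2⟩, fun ⟨x, h1, h2⟩ ↦ ⟨⟨x, mem_H_of_mem h1 (f v).2⟩, h1, h2⟩⟩

instance Dfn.forall_mem (f : (α → H θ) → H θ) [IsVar f] (P : (α → H θ) → ZFSet.{u} → Prop)
    [Dfn (fun w : α ⊕ Unit → H θ ↦ P (fun i ↦ w (Sum.inl i)) (w (Sum.inr ())).1)] :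
    Dfn (fun v ↦ ∀ x ∈ (f v).1, P v x) :=
  Dfn.congr (inferInstance : Dfn (fun v ↦ ∀ x : H θ, x.1 ∈ (f v).1 → P v x.1)) fun v ↦
    ⟨fun h x hx ↦ h ⟨x, mem_H_of_mem hx (f v).2⟩ hx, fun h x hx ↦ h x.1 hx⟩

instance Dfn.coe_eq (f g : (α → H θ) → H θ) [IsVar f] [IsVar g] :
    Dfn (fun v ↦ (f v).1 = (g v).1) :=
  Dfn.congr (inferInstance : Dfn (fun v ↦ f v = g v)) fun _ ↦ Subtype.ext_iff

instance Dfn.isOrdinal (f : (α → H θ) → H θ) [IsVar f] : Dfn (fun v ↦ (f v).1.IsOrdinal) :=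
  Dfn.congr (inferInstance : Dfn (fun v ↦ (∀ y ∈ (f v).1, y ⊆ (f v).1) ∧
    ∀ y ∈ (f v).1, ∀ z ∈ y, z ⊆ y)) fun _ ↦ ZFSet.isOrdinal_iff_forall_mem_isTransitive.symm

instance Dfn.eq_pair [hθ : Fact θ.IsRegular] (f g h : (α → H θ) → H θ) [IsVar f] [IsVar g]
    [IsVar h] : Dfn (fun v ↦ (f v).1 = pair (g v).1 (h v).1) :=
  Dfn.congr (inferInstance : Dfn (fun v ↦ ∀ z : H θ, z.1 ∈ (f v).1 ↔
    (∀ w : H θ, w.1 ∈ z.1 ↔ w.1 = (g v).1) ∨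
      ∀ w : H θ, w.1 ∈ z.1 ↔ w.1 = (g v).1 ∨ w.1 = (h v).1)) fun v ↦ by
    have h0 := hθ.out.aleph0_le
    have hext {a b : ZFSet.{u}} (ha : a ∈ H θ) (hb : b ∈ H θ) :
        (∀ w : H θ, w.1 ∈ a ↔ w.1 ∈ b) ↔ a = b :=
      ⟨fun h ↦ ZFSet.ext fun w ↦ ⟨fun hw ↦ (h ⟨w, mem_H_of_mem hw ha⟩).1 hw,
        fun hw ↦ (h ⟨w, mem_H_of_mem hw hb⟩).2 hw⟩, fun h w ↦ h ▸ Iff.rfl⟩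
    have h1 := singleton_mem_H h0 (g v).2
    have h2 := insert_mem_H h0 (g v).2 (singleton_mem_H h0 (h v).2)
    rw [← hext (f v).2 (pair_mem_H h0 (g v).2 (h v).2)]
    refine forall_congr' fun z ↦ iff_congr Iff.rfl ?_
    rw [pair, mem_pair, ← hext z.2 h1, ← hext z.2 h2]
    simp

instance Dfn.pair_mem [hθ : Fact θ.IsRegular] (f g h : (α → H θ) → H θ) [IsVar f] [IsVar g]
    [IsVar h] : Dfn (fun v ↦ pair (g v).1 (h v).1 ∈ (f v).1) :=
  Dfn.congr (inferInstance : Dfn (fun v ↦ ∃ p ∈ (f v).1, p = pair (g v).1 (h v).1)) fun v ↦ by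
    simp

/-- The graph of an injection of `x` into `c` has size below `θ`, hence lies in `H θ`. It is stored
as a relation indexing `x` by `c`, so that an element of `x` can be recovered from its index. -/
theorem card_le_iff_exists_mem_H [hθ : Fact θ.IsRegular] {x c : ZFSet.{u}} (hx : x ∈ H θ)
    (hc : c ∈ H θ) : x.card ≤ c.card ↔ ∃ f : H θ,
      (∀ j ∈ c, ∀ z ∈ x, ∀ z' ∈ x, pair j z ∈ f.1 → pair j z' ∈ f.1 → z = z') ∧
      ∀ z ∈ x, ∃ j ∈ c, pair j z ∈ f.1 := by
  have h0 := hθ.out.aleph0_le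
  rw [← Cardinal.lift_le.{u + 1}, ← cardinalMk_coe_sort, ← cardinalMk_coe_sort]
  constructor
  · rintro ⟨g⟩
    have hf : ZFSet.range (fun z : x ↦ pair (g z).1 z.1) ∈ H θ := by
      refine range_mem_H ?_ fun z ↦ pair_mem_H h0 (mem_H_of_mem (g z).2 hc) (mem_H_of_mem z.2 hx)
      rw [cardinalMk_coe_sort, Cardinal.lift_lt]
      exact card_lt_of_mem_H hx
    refine ⟨⟨_, hf⟩, fun j _ z _ z' _ h1 h2 ↦ ?_, fun z hz ↦ ?_⟩
    · obtain ⟨y, hy⟩ := ZFSet.mem_range.1 h1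
      obtain ⟨y', hy'⟩ := ZFSet.mem_range.1 h2
      rw [pair_inj] at hy hy'
      rw [← hy.2, ← hy'.2, g.injective (Subtype.ext (hy.1.trans hy'.1.symm))]
    · exact ⟨(g ⟨z, hz⟩).1, (g ⟨z, hz⟩).2, ZFSet.mem_range.2 ⟨⟨z, hz⟩, rfl⟩⟩
  · rintro ⟨f, h1, h2⟩
    choose g hg1 hg2 using h2
    refine mk_le_of_injective (f := fun z : x ↦ (⟨g z.1 z.2, hg1 z.1 z.2⟩ : c)) fun z z' h ↦ ?_
    have h3 : g z.1 z.2 = g z'.1 z'.2 := congrArg Subtype.val h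
    exact Subtype.ext (h1 _ (hg1 z.1 z.2) z.1 z.2 z'.1 z'.2 (hg2 _ _) (h3 ▸ hg2 z'.1 z'.2))

instance Dfn.card_le [Fact θ.IsRegular] (f g : (α → H θ) → H θ) [IsVar f] [IsVar g] :
    Dfn (fun v ↦ (f v).1.card ≤ (g v).1.card) :=
  Dfn.congr (inferInstance : Dfn (fun v ↦ ∃ k : H θ,
      (∀ j ∈ (g v).1, ∀ z ∈ (f v).1, ∀ z' ∈ (f v).1, pair j z ∈ k.1 → pair j z' ∈ k.1 → z = z') ∧
      ∀ z ∈ (f v).1, ∃ j ∈ (g v).1, pair j z ∈ k.1))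
    fun v ↦ (card_le_iff_exists_mem_H (f v).2 (g v).2).symm

end DefinableNotions

/-! ### Closure properties of elementary submodels of `H θ` -/

section Submodel

variable {θ κ : Cardinal.{u}} [hθ : Fact θ.IsRegular] {M : Set ZFSet.{u}} {a b f x y : ZFSet.{u}}

theorem IsElementarySubmodel.mem_of_apply (hM : IsElementarySubmodel M (H θ)) (hf : f ∈ M)
    (ha : a ∈ M) (hab : pair a b ∈ f) (huniq : ∀ c, pair a c ∈ f → c = b) : b ∈ M := by
  have hb := (mem_H_of_pair_mem hab (hM.subset hf)).2
  refine hM.mem_of_unique (α := Fin 2) (fun v y ↦ pair (v 1).1 y.1 ∈ (v 0).1)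
    ![⟨f, hM.subset hf⟩, ⟨a, hM.subset ha⟩] (by simp [Fin.forall_fin_two, hf, ha]) ⟨b, hb⟩ hab
    fun y hy ↦ Subtype.ext (huniq _ hy)

theorem IsElementarySubmodel.pair_mem (hM : IsElementarySubmodel M (H θ)) (ha : a ∈ M)
    (hb : b ∈ M) : pair a b ∈ M := by
  have hp := pair_mem_H hθ.out.aleph0_le (hM.subset ha) (hM.subset hb)
  refine hM.mem_of_unique (α := Fin 2) (fun v y ↦ y.1 = pair (v 0).1 (v 1).1)
    ![⟨a, hM.subset ha⟩, ⟨b, hM.subset hb⟩] (by simp [Fin.forall_fin_two, hb, ha]) ⟨_, hp⟩ rfl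
    fun y hy ↦ Subtype.ext hy

theorem IsElementarySubmodel.empty_mem (hM : IsElementarySubmodel M (H θ)) : ∅ ∈ M := by
  refine hM.mem_of_unique (α := Fin 0) (fun v y ↦ ∀ z ∈ y.1, ¬ z = z) ![] (fun i ↦ i.elim0)
    ⟨∅, empty_mem_H hθ.out.aleph0_le⟩ (by simp) fun y hy ↦ Subtype.ext ?_
  exact (ZFSet.eq_empty _).2 fun z hz ↦ hy z hz rfl

/-- The domain of a relation in `M` belongs to `M`. -/
theorem IsElementarySubmodel.dom_mem (hM : IsElementarySubmodel M (H θ)) (hf : f ∈ M)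
    (hx : x ∈ H θ) (h : ∀ a, a ∈ x ↔ ∃ b, pair a b ∈ f) : x ∈ M := by
  have hfH := hM.subset hf
  have key (y : H θ) : (∀ z : H θ, z.1 ∈ y.1 ↔ ∃ w : H θ, pair z.1 w.1 ∈ f) ↔ y.1 = x := by
    constructor
    · intro hy
      ext z
      rw [h]
      constructor
      · intro hz
        obtain ⟨w, hw⟩ := (hy ⟨z, mem_H_of_mem hz y.2⟩).1 hz
        exact ⟨w, hw⟩
      · rintro ⟨b, hb⟩
        obtain ⟨h1, h2⟩ := mem_H_of_pair_mem hb hfH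
        exact (hy ⟨z, h1⟩).2 ⟨⟨b, h2⟩, hb⟩
    · rintro hy z
      rw [hy, h]
      exact ⟨fun ⟨b, hb⟩ ↦ ⟨⟨b, (mem_H_of_pair_mem hb hfH).2⟩, hb⟩, fun ⟨b, hb⟩ ↦ ⟨b, hb⟩⟩
  exact hM.mem_of_unique (α := Fin 1)
    (fun v y ↦ ∀ z : H θ, z.1 ∈ y.1 ↔ ∃ w : H θ, pair z.1 w.1 ∈ (v 0).1)
    ![⟨f, hfH⟩] (by simp [hf]) ⟨x, hx⟩ ((key _).2 rfl) fun y hy ↦ Subtype.ext ((key y).1 hy)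

/-- The range of a relation in `M` belongs to `M`. -/
theorem IsElementarySubmodel.rng_mem (hM : IsElementarySubmodel M (H θ)) (hf : f ∈ M)
    (hx : x ∈ H θ) (h : ∀ b, b ∈ x ↔ ∃ a, pair a b ∈ f) : x ∈ M := by
  have hfH := hM.subset hf
  have key (y : H θ) : (∀ z : H θ, z.1 ∈ y.1 ↔ ∃ w : H θ, pair w.1 z.1 ∈ f) ↔ y.1 = x := by
    constructor
    · intro hy
      ext z
      rw [h]
      constructor
      · intro hz
        obtain ⟨w, hw⟩ := (hy ⟨z, mem_H_of_mem hz y.2⟩).1 hz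
        exact ⟨w, hw⟩
      · rintro ⟨b, hb⟩
        obtain ⟨h1, h2⟩ := mem_H_of_pair_mem hb hfH
        exact (hy ⟨z, h2⟩).2 ⟨⟨b, h1⟩, hb⟩
    · rintro hy z
      rw [hy, h]
      exact ⟨fun ⟨b, hb⟩ ↦ ⟨⟨b, (mem_H_of_pair_mem hb hfH).1⟩, hb⟩, fun ⟨b, hb⟩ ↦ ⟨b, hb⟩⟩
  exact hM.mem_of_unique (α := Fin 1)
    (fun v y ↦ ∀ z : H θ, z.1 ∈ y.1 ↔ ∃ w : H θ, pair w.1 z.1 ∈ (v 0).1)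
    ![⟨f, hfH⟩] (by simp [hf]) ⟨x, hx⟩ ((key _).2 rfl) fun y hy ↦ Subtype.ext ((key y).1 hy)

theorem IsElementarySubmodel.card_mem (hM : IsElementarySubmodel M (H θ)) (hx : x ∈ M) :
    x.card.ord.toZFSet ∈ M := by
  have hxH := hM.subset hx
  refine hM.mem_of_unique (α := Fin 1)
    (fun v y ↦ y.1.IsOrdinal ∧ (v 0).1.card ≤ y.1.card ∧ ∀ z ∈ y.1, ¬ (v 0).1.card ≤ z.card)
    ![⟨x, hxH⟩] (by simp [hx]) ⟨_, card_ord_toZFSet_mem_H hxH⟩ ?_ ?_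
  · refine ⟨ZFSet.isOrdinal_toZFSet _, by simp, fun z hz ↦ ?_⟩
    obtain ⟨a, ha, rfl⟩ := Ordinal.mem_toZFSet_iff.1 hz
    simpa using Cardinal.lt_ord.1 ha
  · rintro y ⟨h1, h2, h3⟩
    obtain ⟨o, ho⟩ := isOrdinal_iff_mem_range_toZFSet.1 h1
    refine Subtype.ext ?_
    rw [← ho] at h2 h3 ⊢
    simp only [Matrix.cons_val_zero, Ordinal.card_toZFSet] at h2
    congr 1
    refine le_antisymm (le_of_not_gt fun hlt ↦ ?_) (Cardinal.ord_le.2 h2)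
    exact h3 _ (Ordinal.toZFSet_mem_toZFSet_iff.2 hlt) (by simp)

/-- By elementarity `M` contains an indexing of `x` by `c`; each element of `x` is definable from
it, `x` and an index, which lies in `M`. -/
theorem IsElementarySubmodel.subset_of_card_le (hM : IsElementarySubmodel M (H θ)) {c : ZFSet.{u}}
    (hc : c ∈ M) (hcM : ∀ z ∈ c, z ∈ M) (hx : x ∈ M) (h : x.card ≤ c.card) : ∀ z ∈ x, z ∈ M := by
  have hxH := hM.subset hx
  have hcH := hM.subset hc
  obtain ⟨f, hf, h1, h2⟩ := hM.exists_mem (α := Fin 2) (fun v f ↦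
    (∀ j ∈ (v 1).1, ∀ z ∈ (v 0).1, ∀ z' ∈ (v 0).1, pair j z ∈ f.1 → pair j z' ∈ f.1 → z = z') ∧
      ∀ z ∈ (v 0).1, ∃ j ∈ (v 1).1, pair j z ∈ f.1) ![⟨x, hxH⟩, ⟨c, hcH⟩]
    (by simp [Fin.forall_fin_two, hx, hc]) ((card_le_iff_exists_mem_H hxH hcH).1 h)
  intro z hz
  obtain ⟨j, hj, hjz⟩ := h2 z hz
  have hjM := hcM j hj
  have hzH := mem_H_of_mem hz hxH
  refine hM.mem_of_unique (α := Fin 3) (fun v y ↦ y.1 ∈ (v 2).1 ∧ pair (v 1).1 y.1 ∈ (v 0).1)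
    ![f, ⟨j, hM.subset hjM⟩, ⟨x, hxH⟩] (by simp [Fin.forall_fin_succ, hf, hjM, hx])
    ⟨z, hzH⟩ ⟨hz, hjz⟩ fun y hy ↦ Subtype.ext (h1 j hj _ hy.1 _ hz hy.2 hjz)

end Submodel

section ClosedSubmodel

variable {θ κ : Cardinal.{u}} [hθ : Fact θ.IsRegular] {M x : ZFSet.{u}}

/-- The constant function `∅` on `i` is in `M` by closure, and `i` is its domain. -/
theorem toZFSet_mem_of_isClosedUnder (hκθ : κ ≤ θ)
    (hM : IsElementarySubmodel (M : Set ZFSet.{u}) (H θ)) (hcl : IsClosedUnder κ M)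
    {i : Ordinal.{u}} (hi : i < κ.ord) : i.toZFSet ∈ M := by
  have hf := hcl i hi (initialSeq_mem_funs (f := fun _ ↦ ∅) fun _ _ ↦ hM.empty_mem)
  refine hM.dom_mem hf (toZFSet_mem_H (hi.trans_le (Cardinal.ord_le_ord.2 hκθ))) fun a ↦ ?_
  simp only [pair_mem_initialSeq, Ordinal.mem_toZFSet_iff]
  exact ⟨fun ⟨ξ, h1, h2⟩ ↦ ⟨∅, ξ, h1, h2.symm, rfl⟩, fun ⟨_, ξ, h1, h2, _⟩ ↦ ⟨ξ, h1, h2.symm⟩⟩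

/-- An enumeration of `x` in length `|x| < κ` is in `M` by closure, and `x` is its range. -/
theorem mem_of_subset_of_card_lt (hκθ : κ ≤ θ)
    (hM : IsElementarySubmodel (M : Set ZFSet.{u}) (H θ)) (hcl : IsClosedUnder κ M)
    (hxM : x ⊆ M) (hx : x.card < κ) : x ∈ M := by
  have hxH : x ∈ H θ := mem_H_iff.2 ⟨hx.trans_le hκθ, fun y hy ↦ hM.subset (hxM hy)⟩
  have hle : #x ≤ #(Set.Iio x.card.ord) := by
    rw [cardinalMk_coe_sort, Cardinal.mk_Iio_ordinal, Cardinal.card_ord]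
  have hle' : #(Set.Iio x.card.ord) ≤ #x := by
    rw [cardinalMk_coe_sort, Cardinal.mk_Iio_ordinal, Cardinal.card_ord]
  obtain ⟨e⟩ := Cardinal.eq.1 (hle'.antisymm hle)
  classical
  let f : Ordinal.{u} → ZFSet.{u} := fun i ↦ if h : i < x.card.ord then (e ⟨i, h⟩).1 else ∅
  have hf : ∀ i, ∀ h : i < x.card.ord, f i = (e ⟨i, h⟩).1 := fun i h ↦ dif_pos h
  have hfM := hcl _ (Cardinal.ord_lt_ord.2 hx) (initialSeq_mem_funs (f := f) fun i hi ↦ by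
    rw [hf i hi]; exact hxM (e ⟨i, hi⟩).2)
  refine hM.rng_mem hfM hxH fun b ↦ ?_
  simp only [pair_mem_initialSeq]
  constructor
  · intro hb
    obtain ⟨⟨i, hi⟩, hie⟩ := e.surjective ⟨b, hb⟩
    exact ⟨_, i, hi, rfl, by rw [hf i hi, hie]⟩
  · rintro ⟨_, i, hi, -, rfl⟩
    rw [hf i hi]; exact (e ⟨i, hi⟩).2

end ClosedSubmodel
end Davies

namespace Davies

open ZFSet Ordinal Order Set

/-! ### Coding a covering by an element of `H θ` -/

section Coding

variable {θ κ χ : Cardinal.{u}} {e k c x y z X : ZFSet.{u}}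

/-- The sets of ordinals coded by a set of triples `((η, i), x)`, where `i < κ`. -/
def decodedCover (κ : Cardinal.{u}) (e : ZFSet.{u}) (η : Ordinal.{u}) : Set Ordinal.{u} :=
  {o | ∃ i < κ.ord, pair (pair η.toZFSet i.toZFSet) o.toZFSet ∈ e}

/-- The ordinals that belong to a set. -/
def ordinalsIn (x : ZFSet.{u}) : Set Ordinal.{u} := {o | o.toZFSet ∈ x}

theorem mem_ordinalsIn {o : Ordinal.{u}} : o ∈ ordinalsIn x ↔ o.toZFSet ∈ x := Iff.rfl

/-- The set of ordinals in `S` below `b`. -/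
noncomputable def ordinalsBelow (b : Ordinal.{u}) (S : Set Ordinal.{u}) : ZFSet.{u} :=
  ZFSet.sep (fun z ↦ ∃ o ∈ S, o.toZFSet = z) b.toZFSet

/-- `X` has smaller cardinality than the cardinal `k`. -/
def CardLtIn (k X : ZFSet.{u}) : Prop := ∃ i ∈ k, X.card ≤ i.card

/-- The index `η` covers all elements of `X` in the sense of the code `e`. -/
def CodeCovers (e k η X : ZFSet.{u}) : Prop :=
  ∀ x ∈ X, x ⊆ η ∧ ∃ i ∈ k, pair (pair η i) x ∈ e

/-- A formulation in `H θ` of the assertion that `e` is a function that codes a covering for the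
cardinals `k` and `c`. -/
def IsCoveringCode (θ : Cardinal.{u}) (e k c : ZFSet.{u}) : Prop :=
  (∀ z w w' : H θ, pair z.1 w.1 ∈ e → pair z.1 w'.1 ∈ e → w = w') ∧
  (∀ X : H θ, (∀ x ∈ X.1, x.IsOrdinal ∧ x.card ≤ c.card) → CardLtIn k X.1 →
    ∃ η : H θ, (η.1.IsOrdinal ∧ c ⊆ η.1 ∧ η.1.card ≤ c.card) ∧ CodeCovers e k η.1 X.1) ∧
  ∀ α : H θ, α.1.IsOrdinal → α.1.card ≤ c.card → ∃ w : H θ, CardLtIn k w.1 ∧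
    (∀ x ∈ α.1, c ⊆ x → ∃ W ∈ w.1, x ∈ W) ∧
    ∀ W ∈ w.1, (∀ x ∈ W, x ∈ α.1 ∧ c ⊆ x) ∧
      ∀ X : H θ, X.1 ⊆ W → CardLtIn k X.1 → ∃ η ∈ W, CodeCovers e k η X.1

instance Dfn.cardLtIn {α : Type} [Fact θ.IsRegular] (f g : (α → H θ) → H θ) [IsVar f] [IsVar g] :
    Dfn (fun v ↦ CardLtIn (f v).1 (g v).1) :=
  (inferInstance : Dfn (fun v ↦ ∃ i ∈ (f v).1, (g v).1.card ≤ i.card))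

instance Dfn.pair_pair_mem {α : Type} [hθ : Fact θ.IsRegular] (f g h l : (α → H θ) → H θ)
    [IsVar f] [IsVar g] [IsVar h] [IsVar l] :
    Dfn (fun v ↦ pair (pair (f v).1 (g v).1) (h v).1 ∈ (l v).1) :=
  Dfn.congr (inferInstance : Dfn (fun v ↦ ∃ q : H θ, q.1 = pair (f v).1 (g v).1 ∧
    pair q.1 (h v).1 ∈ (l v).1)) fun v ↦
    ⟨fun ⟨_, h1, h2⟩ ↦ h1 ▸ h2, fun h1 ↦
      ⟨⟨_, pair_mem_H hθ.out.aleph0_le (f v).2 (g v).2⟩, rfl, h1⟩⟩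

instance Dfn.codeCovers {α : Type} [Fact θ.IsRegular] (f g h l : (α → H θ) → H θ)
    [IsVar f] [IsVar g] [IsVar h] [IsVar l] :
    Dfn (fun v ↦ CodeCovers (f v).1 (g v).1 (h v).1 (l v).1) :=
  (inferInstance : Dfn (fun v ↦ ∀ x ∈ (l v).1, x ⊆ (h v).1 ∧
    ∃ i ∈ (g v).1, pair (pair (h v).1 i) x ∈ (f v).1))

theorem exists_isCoveringCode_mem [Fact θ.IsRegular] {M : Set ZFSet.{u}}
    (hM : IsElementarySubmodel M (H θ)) (hk : k ∈ M) (hc : c ∈ M)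
    (h : ∃ e ∈ H θ, IsCoveringCode θ e k c) : ∃ e ∈ M, IsCoveringCode θ e k c := by
  obtain ⟨e, he, h⟩ := h
  obtain ⟨e', he', h'⟩ := hM.exists_mem (α := Fin 2) (fun v e ↦
    (∀ z w w' : H θ, pair z.1 w.1 ∈ e.1 → pair z.1 w'.1 ∈ e.1 → w = w') ∧
    (∀ X : H θ, (∀ x ∈ X.1, x.IsOrdinal ∧ x.card ≤ (v 1).1.card) → CardLtIn (v 0).1 X.1 →
      ∃ η : H θ, (η.1.IsOrdinal ∧ (v 1).1 ⊆ η.1 ∧ η.1.card ≤ (v 1).1.card) ∧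
        CodeCovers e.1 (v 0).1 η.1 X.1) ∧
    ∀ α : H θ, α.1.IsOrdinal → α.1.card ≤ (v 1).1.card → ∃ w : H θ, CardLtIn (v 0).1 w.1 ∧
      (∀ x ∈ α.1, (v 1).1 ⊆ x → ∃ W ∈ w.1, x ∈ W) ∧
      ∀ W ∈ w.1, (∀ x ∈ W, x ∈ α.1 ∧ (v 1).1 ⊆ x) ∧
        ∀ X : H θ, X.1 ⊆ W → CardLtIn (v 0).1 X.1 → ∃ η ∈ W, CodeCovers e.1 (v 0).1 η X.1)
    ![⟨k, hM.subset hk⟩, ⟨c, hM.subset hc⟩] (by simp [Fin.forall_fin_two, hk, hc]) ⟨⟨e, he⟩, h⟩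
  exact ⟨e', he', h'⟩

theorem cardLtIn_iff : CardLtIn κ.ord.toZFSet X ↔ X.card < κ := by
  constructor
  · rintro ⟨i, hi, h⟩
    obtain ⟨a, ha, rfl⟩ := mem_toZFSet_iff.1 hi
    rw [card_toZFSet] at h
    exact h.trans_lt (lt_ord.1 ha)
  · exact fun h ↦ ⟨X.card.ord.toZFSet, toZFSet_mem_toZFSet_iff.2 (ord_lt_ord.2 h), by simp⟩

theorem exists_toZFSet_eq (hx : x.IsOrdinal) : ∃ o : Ordinal.{u}, o.toZFSet = x :=
  isOrdinal_iff_mem_range_toZFSet.1 hx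

theorem mem_ordinalsBelow {b : Ordinal.{u}} {S : Set Ordinal.{u}} (hS : S ⊆ Iio b) :
    z ∈ ordinalsBelow b S ↔ ∃ o ∈ S, o.toZFSet = z := by
  rw [ordinalsBelow, ZFSet.mem_sep, and_iff_right_iff_imp]
  rintro ⟨o, ho, rfl⟩
  exact toZFSet_mem_toZFSet_iff.2 (hS ho)

theorem ordinalsBelow_subset {b : Ordinal.{u}} {S : Set Ordinal.{u}} :
    ordinalsBelow b S ⊆ b.toZFSet := ZFSet.sep_subset

theorem ordinalsIn_ordinalsBelow {b : Ordinal.{u}} {S : Set Ordinal.{u}} (hS : S ⊆ Iio b) :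
    ordinalsIn (ordinalsBelow b S) = S := by
  ext o
  simp [ordinalsIn, mem_ordinalsBelow hS, toZFSet_injective.eq_iff]

theorem mk_ordinalsIn_le : #(ordinalsIn x) ≤ Cardinal.lift.{u + 1} x.card := by
  rw [← cardinalMk_coe_sort]
  exact mk_le_of_injective (f := fun o : ordinalsIn x ↦ (⟨o.1.toZFSet, o.2⟩ : x)) fun o o' h ↦
    Subtype.ext (toZFSet_injective (congrArg Subtype.val h))

theorem card_lt_of_forall_exists_eq {ι : Type (u + 1)} {f : ι → ZFSet.{u}}
    (h : ∀ z ∈ x, ∃ i, f i = z) (hι : #ι < Cardinal.lift.{u + 1} κ) : x.card < κ := by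
  rw [← Cardinal.lift_lt.{u, u + 1}, ← cardinalMk_coe_sort]
  choose g hg using h
  refine (mk_le_of_injective (f := fun z : x ↦ g z.1 z.2) fun z z' hz ↦ ?_).trans_lt hι
  apply Subtype.ext
  rw [← hg z.1 z.2, ← hg z'.1 z'.2]
  exact congrArg f hz

theorem card_ordinalsBelow_lt {b : Ordinal.{u}} {S : Set Ordinal.{u}} (hS : S ⊆ Iio b)
    (h : #S < Cardinal.lift.{u + 1} κ) : (ordinalsBelow b S).card < κ := by
  refine card_lt_of_forall_exists_eq (f := fun o : S ↦ o.1.toZFSet) (fun z hz ↦ ?_) h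
  obtain ⟨o, ho, hoz⟩ := (mem_ordinalsBelow hS).1 hz
  exact ⟨⟨o, ho⟩, hoz⟩

theorem subset_decodedCover_iff {η : Ordinal.{u}} :
    CodeCovers e κ.ord.toZFSet η.toZFSet X ∧ (∀ x ∈ X, x.IsOrdinal) ↔
      ordinalsIn X ⊆ decodedCover κ e η ∩ Iic η ∧ ∀ x ∈ X, x.IsOrdinal := by
  refine and_congr_left fun hX ↦ ⟨fun h o ho ↦ ?_, fun h x hx ↦ ?_⟩
  · obtain ⟨h1, i, hi, h2⟩ := h _ (mem_ordinalsIn.1 ho)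
    obtain ⟨a, ha, rfl⟩ := mem_toZFSet_iff.1 hi
    exact ⟨⟨a, ha, h2⟩, toZFSet_subset_toZFSet_iff.1 h1⟩
  · obtain ⟨o, rfl⟩ := exists_toZFSet_eq (hX x hx)
    obtain ⟨⟨i, hi, h1⟩, h2⟩ := h hx
    exact ⟨toZFSet_subset_toZFSet_iff.2 h2, _, toZFSet_mem_toZFSet_iff.2 hi, h1⟩

theorem card_toZFSet_le_iff {o : Ordinal.{u}} :
    o.toZFSet.card ≤ χ.ord.toZFSet.card ↔ o < (succ χ).ord := by
  rw [card_toZFSet, card_toZFSet, card_ord, lt_ord, lt_succ_iff]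

/-- Being a covering is absolute to `H θ`: since `χ⁺ < θ`, all small subsets of `χ⁺`, all `α < χ⁺`
and all the decompositions are elements of `H θ`. -/
theorem isCoveringCode_iff (hκθ : κ ≤ θ) (hχ : succ χ < θ) :
    IsCoveringCode θ e κ.ord.toZFSet χ.ord.toZFSet ↔
      (∀ z w w' : H θ, pair z.1 w.1 ∈ e → pair z.1 w'.1 ∈ e → w = w') ∧
        IsCovering κ χ (decodedCover κ e) := by
  have hbH : (succ χ).ord.toZFSet ∈ H θ := toZFSet_mem_H (ord_lt_ord.2 hχ)
  refine and_congr Iff.rfl ⟨fun ⟨h1, h2⟩ ↦ ⟨fun X hX hXκ ↦ ?_, fun α hα ↦ ?_⟩,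
    fun h ↦ ⟨fun X hX hXκ ↦ ?_, fun α hα hαχ ↦ ?_⟩⟩
  · have hX' : ∀ x ∈ ordinalsBelow (succ χ).ord X,
        x.IsOrdinal ∧ x.card ≤ χ.ord.toZFSet.card := fun x hx ↦ by
      obtain ⟨o, ho, rfl⟩ := (mem_ordinalsBelow hX).1 hx
      exact ⟨isOrdinal_toZFSet _, card_toZFSet_le_iff.2 (hX ho)⟩
    obtain ⟨η, ⟨hη1, hη2, hη3⟩, hη⟩ := h1 ⟨_, mem_H_of_subset ordinalsBelow_subset hbH⟩
      hX' (cardLtIn_iff.2 (card_ordinalsBelow_lt hX hXκ))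
    obtain ⟨η, hηH⟩ := η
    obtain ⟨η, rfl⟩ := exists_toZFSet_eq hη1
    refine ⟨η, ⟨toZFSet_subset_toZFSet_iff.1 hη2, card_toZFSet_le_iff.1 hη3⟩, ?_⟩
    have := (subset_decodedCover_iff.1 ⟨hη, fun x hx ↦ (hX' x hx).1⟩).1
    rwa [ordinalsIn_ordinalsBelow hX] at this
  · have hαH : α.toZFSet ∈ H θ := toZFSet_mem_H (hα.trans (ord_lt_ord.2 hχ))
    obtain ⟨w, hw1, hw2, hw3⟩ := h2 ⟨_, hαH⟩ (isOrdinal_toZFSet _) (card_toZFSet_le_iff.2 hα)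
    have hwα {W x : ZFSet.{u}} (hW : W ∈ w.1) (hx : x ∈ W) :
        ∃ o ∈ Ico χ.ord α, o.toZFSet = x := by
      obtain ⟨h3, h4⟩ := (hw3 W hW).1 x hx
      obtain ⟨o, ho, rfl⟩ := mem_toZFSet_iff.1 h3
      exact ⟨o, ⟨toZFSet_subset_toZFSet_iff.1 h4, ho⟩, rfl⟩
    refine ⟨ordinalsIn '' {W | W ∈ w.1}, ?_, ?_, ?_⟩
    · refine mk_image_le.trans_lt ?_
      have := cardLtIn_iff.1 hw1
      rw [← Cardinal.lift_lt.{u, u + 1}, ← cardinalMk_coe_sort] at this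
      exact this
    · ext o
      simp only [Set.mem_sUnion, Set.mem_image, Set.mem_ofPred_eq, exists_exists_and_eq_and]
      constructor
      · rintro ⟨W, hW, ho⟩
        obtain ⟨o', ho', h⟩ := hwα hW (mem_ordinalsIn.1 ho)
        rwa [← toZFSet_injective h]
      · intro ho
        obtain ⟨W, hW, h⟩ := hw2 o.toZFSet (toZFSet_mem_toZFSet_iff.2 ho.2)
          (toZFSet_subset_toZFSet_iff.2 ho.1)
        exact ⟨W, hW, h⟩
    · rintro _ ⟨W, hW, rfl⟩ X hX hXκ
      have hXα : X ⊆ Iio α := fun o ho ↦ by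
        obtain ⟨o', ho', h⟩ := hwα hW (mem_ordinalsIn.1 (hX ho))
        rw [← toZFSet_injective h]
        exact ho'.2
      have hX' {z : ZFSet.{u}} (hz : z ∈ ordinalsBelow α X) : z ∈ W ∧ z.IsOrdinal := by
        obtain ⟨o, ho, rfl⟩ := (mem_ordinalsBelow hXα).1 hz
        exact ⟨hX ho, isOrdinal_toZFSet _⟩
      obtain ⟨η, hη1, hη⟩ := (hw3 W hW).2 ⟨_, mem_H_of_subset ordinalsBelow_subset hαH⟩
        (fun z hz ↦ (hX' hz).1) (cardLtIn_iff.2 (card_ordinalsBelow_lt hXα hXκ))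
      obtain ⟨η, -, rfl⟩ := hwα hW hη1
      refine ⟨η, hη1, ?_⟩
      have := (subset_decodedCover_iff.1 ⟨hη, fun x hx ↦ (hX' hx).2⟩).1
      rwa [ordinalsIn_ordinalsBelow hXα] at this
  · have hXs : ordinalsIn X.1 ⊆ Iio (succ χ).ord := fun o ho ↦ card_toZFSet_le_iff.1 (hX _ ho).2
    obtain ⟨η, hη, h1⟩ := h.cover _ hXs
      (mk_ordinalsIn_le.trans_lt (Cardinal.lift_lt.2 (cardLtIn_iff.1 hXκ)))
    refine ⟨⟨η.toZFSet, toZFSet_mem_H (hη.2.trans (ord_lt_ord.2 hχ))⟩,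
      ⟨isOrdinal_toZFSet _, toZFSet_subset_toZFSet_iff.2 hη.1, card_toZFSet_le_iff.2 hη.2⟩, ?_⟩
    exact (subset_decodedCover_iff.2 ⟨h1, fun x hx ↦ (hX x hx).1⟩).1
  · obtain ⟨α, hαH⟩ := α
    obtain ⟨α, rfl⟩ := exists_toZFSet_eq hα
    replace hαχ := card_toZFSet_le_iff.1 hαχ
    obtain ⟨𝒲, h1, h2, h3⟩ := h.decomposes α hαχ
    have h𝒲 {W : Set Ordinal.{u}} (hW : W ∈ 𝒲) : W ⊆ Ico χ.ord α := h2 ▸ subset_sUnion_of_mem hW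
    let w := ZFSet.sep (fun z ↦ ∃ W ∈ 𝒲, ordinalsBelow α W = z) (ZFSet.powerset α.toZFSet)
    have hmem {z : ZFSet.{u}} : z ∈ w ↔ ∃ W ∈ 𝒲, ordinalsBelow α W = z := by
      rw [ZFSet.mem_sep, and_iff_right_iff_imp]
      rintro ⟨W, hW, rfl⟩
      exact ZFSet.mem_powerset.2 ordinalsBelow_subset
    have hwκ : w.card < κ := by
      refine card_lt_of_forall_exists_eq (f := fun W : 𝒲 ↦ ordinalsBelow α W.1) (fun z hz ↦ ?_) h1
      obtain ⟨W, hW, hWz⟩ := hmem.1 hz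
      exact ⟨⟨W, hW⟩, hWz⟩
    have hwH : w ∈ H θ := mem_H_iff.2 ⟨hwκ.trans_le hκθ, fun z hz ↦ by
      obtain ⟨W, -, rfl⟩ := hmem.1 hz
      exact mem_H_of_subset ordinalsBelow_subset hαH⟩
    refine ⟨⟨w, hwH⟩, cardLtIn_iff.2 hwκ, fun x hx hχx ↦ ?_, fun z hz ↦ ?_⟩
    · obtain ⟨o, ho, rfl⟩ := mem_toZFSet_iff.1 hx
      have : o ∈ ⋃₀ 𝒲 := h2 ▸ ⟨toZFSet_subset_toZFSet_iff.1 hχx, ho⟩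
      obtain ⟨W, hW, hoW⟩ := this
      exact ⟨_, hmem.2 ⟨W, hW, rfl⟩,
        (mem_ordinalsBelow ((h𝒲 hW).trans Ico_subset_Iio_self)).2 ⟨o, hoW, rfl⟩⟩
    · obtain ⟨W, hW, rfl⟩ := hmem.1 hz
      have hWα := (h𝒲 hW).trans Ico_subset_Iio_self
      refine ⟨fun x hx ↦ ?_, fun X hX hXκ ↦ ?_⟩
      · obtain ⟨o, ho, rfl⟩ := (mem_ordinalsBelow hWα).1 hx
        exact ⟨toZFSet_mem_toZFSet_iff.2 (hWα ho), toZFSet_subset_toZFSet_iff.2 (h𝒲 hW ho).1⟩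
      · have hXs : ordinalsIn X.1 ⊆ W := fun o ho ↦ by
          obtain ⟨o', ho', h⟩ := (mem_ordinalsBelow hWα).1 (hX (mem_ordinalsIn.1 ho))
          rwa [← toZFSet_injective h]
        obtain ⟨η, hη, h4⟩ := h3 W hW _ hXs
          (mk_ordinalsIn_le.trans_lt (Cardinal.lift_lt.2 (cardLtIn_iff.1 hXκ)))
        refine ⟨η.toZFSet, (mem_ordinalsBelow hWα).2 ⟨η, hη, rfl⟩,
          (subset_decodedCover_iff.2 ⟨h4, fun x hx ↦ ?_⟩).1⟩
        obtain ⟨o, -, rfl⟩ := (mem_ordinalsBelow hWα).1 (hX hx)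
        exact isOrdinal_toZFSet _

theorem exists_isCoveringCode (hGCH : GCH.{u}) (hVWS : VWS.{u}) (hκ : κ.IsRegular) (hκχ : κ ≤ χ)
    (hχ : succ χ < θ) : ∃ e ∈ H θ, IsCoveringCode θ e κ.ord.toZFSet χ.ord.toZFSet := by
  classical
  have hχ0 : ℵ₀ ≤ χ := hκ.aleph0_le.trans hκχ
  have hθ : ℵ₀ ≤ θ := hχ0.trans ((le_succ χ).trans hχ.le)
  obtain ⟨E, hE, hcov⟩ := exists_covering hGCH hVWS hκ hκχ
  have henum (η : Ordinal.{u}) : ∃ g : Ordinal.{u} → Ordinal.{u},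
      (∀ i, g i ≤ η) ∧ E η ∩ Iic η ⊆ g '' Iio κ.ord := by
    have h1 : #(E η) ≤ #(Iio κ.ord) := (hE η).trans_eq (by simp)
    obtain ⟨f⟩ := h1
    -- The default `0` keeps every value at most `η`, so the triples stay in `H θ`.
    refine ⟨fun i ↦ if h : ∃ o : E η, (f o).1 = i ∧ o.1 ≤ η then h.choose.1 else 0,
      fun i ↦ ?_, fun o ho ↦ ?_⟩
    · dsimp only
      split_ifs with h
      · exact h.choose_spec.2
      · exact zero_le
    · have h : ∃ o' : E η, (f o').1 = (f ⟨o, ho.1⟩).1 ∧ o'.1 ≤ η := ⟨⟨o, ho.1⟩, rfl, ho.2⟩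
      refine ⟨(f ⟨o, ho.1⟩).1, (f ⟨o, ho.1⟩).2, ?_⟩
      dsimp only
      rw [dif_pos h, f.injective (Subtype.ext h.choose_spec.1)]
  choose g hg1 hg2 using henum
  let t : Iio (succ χ).ord × Iio κ.ord → ZFSet.{u} := fun p ↦
    pair (pair p.1.1.toZFSet p.2.1.toZFSet) (g p.1.1 p.2.1).toZFSet
  have hκθ : κ ≤ θ := hκχ.trans ((le_succ χ).trans hχ.le)
  have hχθ : (succ χ).ord < θ.ord := ord_lt_ord.2 hχ
  refine ⟨ZFSet.range t, range_mem_H ?_ fun p ↦ ?_, (isCoveringCode_iff hκθ hχ).2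
    ⟨fun z w w' h h' ↦ ?_, ?_⟩⟩
  · rw [mk_prod, Cardinal.mk_Iio_ordinal, Cardinal.mk_Iio_ordinal]
    simp only [card_ord, Cardinal.lift_id, ← Cardinal.lift_mul, Cardinal.lift_lt]
    exact mul_lt_of_lt hθ hχ (hκχ.trans_lt ((lt_succ χ).trans hχ))
  · exact pair_mem_H hθ (pair_mem_H hθ (toZFSet_mem_H (p.1.2.trans hχθ))
      (toZFSet_mem_H (p.2.2.trans_le (ord_le_ord.2 hκθ))))
      (toZFSet_mem_H ((hg1 _ _).trans_lt (p.1.2.trans hχθ)))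
  · obtain ⟨p, hp⟩ := ZFSet.mem_range.1 h
    obtain ⟨p', hp'⟩ := ZFSet.mem_range.1 h'
    obtain ⟨h1, h2⟩ := pair_inj.1 hp
    obtain ⟨h1', h2'⟩ := pair_inj.1 hp'
    obtain ⟨h3, h4⟩ := pair_inj.1 (h1.trans h1'.symm)
    refine Subtype.ext ?_
    rw [← h2, ← h2', toZFSet_injective h3, toZFSet_injective h4]
  · have hcov' : IsCovering κ χ (fun η ↦ E η ∩ Iic η) :=
      ⟨by simpa [inter_assoc] using hcov.cover,
        by simpa [Decomposes, CoverClosed, inter_assoc] using hcov.decomposes⟩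
    refine hcov'.congr fun η hη o ho ↦ ?_
    obtain ⟨i, hi, rfl⟩ := hg2 η ho
    exact ⟨i, hi, ZFSet.mem_range.2 ⟨(⟨η, hη.2⟩, ⟨i, hi⟩), rfl⟩⟩

end Coding
end Davies

namespace Davies

open ZFSet Ordinal Order Set

/-! ### Closed approximation sequences are sage Davies trees -/

section ApproximationSequence

variable {θ κ μ : Cardinal.{u}} {p z : ZFSet.{u}} {M : Ordinal.{u} → ZFSet.{u}}
  {ξ η α : Ordinal.{u}}

theorem mem_initialUnion : z ∈ initialUnion M α ↔ ∃ ξ < α, z ∈ M ξ := by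
  simp [initialUnion]

namespace IsClosedLongApproxSeq

variable [hθ : Fact θ.IsRegular]

theorem toZFSet_mem (hM : IsClosedLongApproxSeq κ θ p μ.ord M) (hμθ : μ ≤ θ) (hα : α < μ.ord) :
    α.toZFSet ∈ M α := by
  refine (hM.elementary α hα).dom_mem (hM.initialSeq_mem α hα)
    (toZFSet_mem_H (hα.trans_le (ord_le_ord.2 hμθ))) fun a ↦ ?_
  simp only [pair_mem_initialSeq, mem_toZFSet_iff]
  exact ⟨fun ⟨ξ, h1, h2⟩ ↦ ⟨M ξ, ξ, h1, h2.symm, rfl⟩, fun ⟨_, ξ, h1, h2, _⟩ ↦ ⟨ξ, h1, h2.symm⟩⟩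

theorem mem_of_lt (hM : IsClosedLongApproxSeq κ θ p μ.ord M) (hξη : ξ < η) (hη : η < μ.ord)
    (h : ξ.toZFSet ∈ M η) : M ξ ∈ M η := by
  refine (hM.elementary η hη).mem_of_apply (hM.initialSeq_mem η hη) h
    (pair_mem_initialSeq.2 ⟨ξ, hξη, rfl, rfl⟩) fun c hc ↦ ?_
  obtain ⟨ξ', -, h1, rfl⟩ := pair_mem_initialSeq.1 hc
  rw [toZFSet_injective h1]

theorem toZFSet_mem_of_lt (hM : IsClosedLongApproxSeq κ θ p μ.ord M) (hκθ : κ ≤ θ)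
    (hα : α < μ.ord) {i : Ordinal.{u}} (hi : i < κ.ord) : i.toZFSet ∈ M α :=
  toZFSet_mem_of_isClosedUnder hκθ (hM.elementary α hα) (hM.closed α hα) hi

theorem card_eq (hM : IsClosedLongApproxSeq κ θ p μ.ord M) (hκθ : κ ≤ θ) (hα : α < μ.ord) :
    (M α).card = κ := by
  refine (lt_succ_iff.1 (hM.card_lt α hα)).antisymm ?_
  have : κ.ord.toZFSet ⊆ M α := fun z hz ↦ by
    obtain ⟨i, hi, rfl⟩ := mem_toZFSet_iff.1 hz
    exact hM.toZFSet_mem_of_lt hκθ hα hi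
  simpa using card_mono this

/-- For `α > 0` the model `M 0` is an element of `M α`, and `κ` is its cardinality. -/
theorem ord_toZFSet_mem (hM : IsClosedLongApproxSeq κ θ p μ.ord M) (hκθ : κ ≤ θ) (h0 : 0 < α)
    (hα : α < μ.ord) : κ.ord.toZFSet ∈ M α := by
  have hel := hM.elementary α hα
  have := hel.card_mem (hM.mem_of_lt h0 hα (by rw [toZFSet_zero]; exact hel.empty_mem))
  rwa [hM.card_eq hκθ (h0.trans hα)] at this

theorem subset_of_toZFSet_mem (hM : IsClosedLongApproxSeq κ θ p μ.ord M) (hκθ : κ ≤ θ)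
    (hξη : ξ ≤ η) (hη : η < μ.ord) (h : ξ.toZFSet ∈ M η) : M ξ ⊆ M η := by
  rcases hξη.eq_or_lt with rfl | hlt
  · exact fun _ h ↦ h
  · refine (hM.elementary η hη).subset_of_card_le
      (hM.ord_toZFSet_mem hκθ (zero_le.trans_lt hlt) hη) (fun z hz ↦ ?_)
      (hM.mem_of_lt hlt hη h) ?_
    · obtain ⟨i, hi, rfl⟩ := mem_toZFSet_iff.1 hz
      exact hM.toZFSet_mem_of_lt hκθ hη hi
    · simp [hM.card_eq hκθ (hlt.trans hη)]

theorem exists_cover (hM : IsClosedLongApproxSeq κ θ p μ.ord M) (hGCH : GCH.{u}) (hVWS : VWS.{u})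
    (hκ : κ.IsRegular) (hκμ : κ < μ) (hμθ : μ < θ) : ∃ E : Ordinal.{u} → Set Ordinal.{u},
      (∀ η < κ.ord, Iic η ⊆ E η) ∧ (∀ χ, κ ≤ χ → χ < μ → IsCovering κ χ E) ∧
      ∀ η < μ.ord, ∀ ξ ∈ E η ∩ Iic η, M ξ ⊆ M η := by
  have hκθ : κ ≤ θ := hκμ.le.trans hμθ.le
  have hκ0 : (0 : Ordinal.{u}) < κ.ord := by
    rw [lt_ord, card_zero]; exact hκ.pos
  have hcode (χ : Cardinal.{u}) : ∃ e, κ ≤ χ → χ < μ → e ∈ M χ.ord ∧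
      IsCoveringCode θ e κ.ord.toZFSet χ.ord.toZFSet := by
    by_cases h : κ ≤ χ ∧ χ < μ
    · have hχμ := ord_lt_ord.2 h.2
      obtain ⟨e, he⟩ := exists_isCoveringCode_mem (hM.elementary χ.ord hχμ)
        (hM.ord_toZFSet_mem hκθ (hκ0.trans_le (ord_le_ord.2 h.1)) hχμ)
        (hM.toZFSet_mem hμθ.le hχμ)
        (exists_isCoveringCode hGCH hVWS hκ h.1 ((succ_le_of_lt h.2).trans_lt hμθ))
      exact ⟨e, fun _ _ ↦ he⟩
    · exact ⟨∅, fun h1 h2 ↦ (h ⟨h1, h2⟩).elim⟩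
  choose e he using hcode
  classical
  refine ⟨fun η ↦ if η < κ.ord then Iic η else decodedCover κ (e η.card) η, fun η hη ↦ ?_,
    fun χ h1 h2 ↦ ?_, fun η hη ξ hξ ↦ ?_⟩
  · simp [hη]
  · refine IsCovering.congr ((isCoveringCode_iff hκθ
      ((succ_le_of_lt h2).trans_lt hμθ)).1 (he χ h1 h2).2).2 fun η hη ↦ ?_
    have hη' : η.card = χ := le_antisymm (lt_succ_iff.1 (lt_ord.1 hη.2)) (ord_le.1 hη.1)
    rw [if_neg ((ord_le_ord.2 h1).trans hη.1).not_gt, hη']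
  · refine hM.subset_of_toZFSet_mem hκθ hξ.2 hη ?_
    have hξE : ξ ∈ if η < κ.ord then Iic η else decodedCover κ (e η.card) η := hξ.1
    split_ifs at hξE with hηκ
    · exact hM.toZFSet_mem_of_lt hκθ hη (lt_of_le_of_lt hξ.2 hηκ)
    · have hκη : κ ≤ η.card := ord_le.1 (not_lt.1 hηκ)
      have hημ : η.card < μ := lt_ord.1 hη
      obtain ⟨h1, h2⟩ := he _ hκη hημ
      have hel := hM.elementary η hη
      have hηM := hM.toZFSet_mem hμθ.le hη
      -- The code was chosen in the model indexed by `|η|`. Since `|η|` is definable from `η ∈ M η`,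
      -- that model is contained in `M η`.
      have hsub := hM.subset_of_toZFSet_mem hκθ (ord_card_le_lt η).1 hη
        (by simpa using hel.card_mem hηM)
      have heM := hsub h1
      obtain ⟨i, hi, h3⟩ := hξE
      refine hel.mem_of_apply heM (hel.pair_mem hηM (hM.toZFSet_mem_of_lt hκθ hη hi)) h3
        fun c hc ↦ ?_
      have heH := hel.subset heM
      obtain ⟨h4, h5⟩ := mem_H_of_pair_mem hc heH
      obtain ⟨-, h6⟩ := mem_H_of_pair_mem h3 heH
      exact congrArg Subtype.val (h2.1 ⟨_, h4⟩ ⟨_, h5⟩ ⟨_, h6⟩ hc h3)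

end IsClosedLongApproxSeq

/-- The union of the `M ξ` for `ξ ∈ W`, where `W` is a set of ordinals below `b`. -/
noncomputable def unionOver (M : Ordinal.{u} → ZFSet.{u}) (b : Ordinal.{u})
    (W : Set Ordinal.{u}) : ZFSet.{u} :=
  ZFSet.sep (fun z ↦ ∃ ξ ∈ W, z ∈ M ξ) (initialUnion M b)

theorem mem_unionOver {b : Ordinal.{u}} {W : Set Ordinal.{u}} (hW : W ⊆ Iio b) :
    z ∈ unionOver M b W ↔ ∃ ξ ∈ W, z ∈ M ξ := by
  rw [unionOver, ZFSet.mem_sep, and_iff_right_iff_imp, mem_initialUnion]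
  exact fun ⟨ξ, h1, h2⟩ ↦ ⟨ξ, hW h1, h2⟩

theorem unionOver_Iio {b : Ordinal.{u}} : unionOver M b (Iio b) = initialUnion M b := by
  ext z
  rw [mem_unionOver Subset.rfl, mem_initialUnion]
  rfl

section CoverClosed

variable {E : Ordinal.{u} → Set Ordinal.{u}} {W : Set Ordinal.{u}} {b : Ordinal.{u}}

theorem CoverClosed.nonempty (hW : CoverClosed κ E W) (hκ : 0 < κ) : W.Nonempty := by
  obtain ⟨η, hη, -⟩ := hW ∅ (empty_subset _) (by simpa using hκ)
  exact ⟨η, hη⟩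

theorem CoverClosed.isElementarySubmodel_unionOver (hW : CoverClosed κ E W) (hκ : ℵ₀ ≤ κ)
    (hWb : W ⊆ Iio b) (hE : ∀ η ∈ W, ∀ ξ ∈ E η ∩ Iic η, M ξ ⊆ M η)
    (hM : ∀ ξ ∈ W, IsElementarySubmodel (M ξ : Set ZFSet.{u}) (H θ)) :
    IsElementarySubmodel (unionOver M b W : Set ZFSet.{u}) (H θ) := by
  have hne : Nonempty W := (hW.nonempty (aleph0_pos.trans_le hκ)).to_subtype
  have heq : (unionOver M b W : Set ZFSet.{u}) = ⋃ ξ : W, (M ξ : Set ZFSet.{u}) := by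
    ext z
    simp [mem_unionOver hWb]
  rw [heq]
  refine isElementarySubmodel_iUnion (fun ξ ξ' ↦ ?_) fun ξ ↦ hM ξ ξ.2
  obtain ⟨η, hη, h⟩ := hW {ξ.1, ξ'.1} (by rintro _ (rfl | rfl); exacts [ξ.2, ξ'.2])
    ((Cardinal.mk_lt_aleph0).trans_le (by simpa using hκ))
  exact ⟨⟨η, hη⟩, fun z hz ↦ hE η hη _ (h (by simp)) hz, fun z hz ↦ hE η hη _ (h (by simp)) hz⟩

/-- A short sequence in the union takes its values in fewer than `κ` models, hence in a single `M
η`. Asking only that sequences in `M ξ` lie in the union lets the lemma apply also to chains that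
acquire them at a later stage. -/
theorem CoverClosed.isClosedUnder_unionOver (hW : CoverClosed κ E W)
    (hWb : W ⊆ Iio b) (hE : ∀ η ∈ W, ∀ ξ ∈ E η ∩ Iic η, M ξ ⊆ M η)
    (hM : ∀ ξ ∈ W, ∀ i < κ.ord, funs i.toZFSet (M ξ) ⊆ unionOver M b W) :
    IsClosedUnder κ (unionOver M b W) := by
  intro i hi f hf
  obtain ⟨hf1, hf2⟩ := mem_funs.1 hf
  have hval {a c : ZFSet.{u}} (h : pair a c ∈ f) : a ∈ i.toZFSet ∧ c ∈ unionOver M b W :=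
    pair_mem_prod.1 (hf1 h)
  have h1 (j : Iio i) : ∃ ξ ∈ W, ∀ c, pair j.1.toZFSet c ∈ f → c ∈ M ξ := by
    obtain ⟨c, hc, huniq⟩ := hf2 _ (toZFSet_mem_toZFSet_iff.2 j.2)
    obtain ⟨ξ, hξ, hcξ⟩ := (mem_unionOver hWb).1 (hval hc).2
    exact ⟨ξ, hξ, fun c' hc' ↦ huniq c' hc' ▸ hcξ⟩
  choose g hgW hg using h1
  obtain ⟨η, hη, h⟩ := hW (Set.range g) (by rintro _ ⟨j, rfl⟩; exact hgW j)
    (mk_range_le.trans_lt (by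
      rw [Cardinal.mk_Iio_ordinal, Cardinal.lift_lt]; exact lt_ord.1 hi))
  refine hM η hη i hi (mem_funs.2 ⟨fun z hz ↦ ?_, hf2⟩)
  obtain ⟨a, ha, c, hc, rfl⟩ := mem_prod.1 (hf1 hz)
  obtain ⟨j, hj, rfl⟩ := mem_toZFSet_iff.1 ha
  exact pair_mem_prod.2 ⟨ha, hE η hη _ (h ⟨⟨j, hj⟩, rfl⟩) (hg ⟨j, hj⟩ c hz)⟩

end CoverClosed

theorem IsClosedLongApproxSeq.isSageDaviesTree [hθ : Fact θ.IsRegular]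
    (hM : IsClosedLongApproxSeq κ θ p μ.ord M) (hGCH : GCH.{u}) (hVWS : VWS.{u})
    (hκ : κ.IsRegular) (hμ : μ.IsRegular) (hκμ : κ < μ) (hμθ : μ < θ) :
    IsSageDaviesTree κ μ θ p M := by
  have hκθ : κ ≤ θ := hκμ.le.trans hμθ.le
  obtain ⟨E, hE0, hEcov, hE⟩ := hM.exists_cover hGCH hVWS hκ hκμ hμθ
  have hcl := CoverClosed.Iio_of_isCovering hE0 hEcov hκμ.le (hμ.cof_ord.ge.trans' hκμ.le)
  have hel : IsElementarySubmodel (initialUnion M μ.ord : Set ZFSet.{u}) (H θ) := by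
    rw [← unionOver_Iio]
    exact hcl.isElementarySubmodel_unionOver hκ.aleph0_le Subset.rfl hE hM.elementary
  have hcl' : IsClosedUnder κ (initialUnion M μ.ord) := by
    rw [← unionOver_Iio]
    exact hcl.isClosedUnder_unionOver Subset.rfl hE fun ξ hξ i hi f hf ↦
      (mem_unionOver Subset.rfl).2 ⟨ξ, hξ, hM.closed ξ hξ i hi hf⟩
  refine
    { elementary := hM.elementary
      param_mem := hM.param_mem
      closed := hM.closed
      card_eq := fun α hα ↦ hM.card_eq hκθ hα
      cover := fun x hx hxκ ↦ mem_of_subset_of_card_lt hκθ hel hcl' (fun z hz ↦ ?_) hxκ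
      decomposition := fun α hα ↦ ?_
      initialSeq_mem := hM.initialSeq_mem
      union_elementary := hel
      union_closed := hcl' }
  -- Since `α ∈ M α`, the union contains every ordinal below `μ`.
  · obtain ⟨o, ho, rfl⟩ := mem_toZFSet_iff.1 (hx hz)
    exact mem_initialUnion.2 ⟨o, ho, hM.toZFSet_mem hμθ.le ho⟩
  · obtain ⟨𝒲, h1, h2, h3⟩ := decomposes_Iio hκ hE0 hEcov α hα.le
    have h𝒲 {W : Set Ordinal.{u}} (hW : W ∈ 𝒲) : W ⊆ Iio α := h2 ▸ subset_sUnion_of_mem hW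
    have h𝒲' {W : Set Ordinal.{u}} (hW : W ∈ 𝒲) {ξ : Ordinal.{u}} (hξ : ξ ∈ W) : ξ < μ.ord :=
      lt_trans (h𝒲 hW hξ) hα
    let 𝒩 := ZFSet.sep (fun z ↦ ∃ W ∈ 𝒲, unionOver M α W = z)
      (ZFSet.powerset (initialUnion M α))
    have hmem {z : ZFSet.{u}} : z ∈ 𝒩 ↔ ∃ W ∈ 𝒲, unionOver M α W = z := by
      rw [ZFSet.mem_sep, and_iff_right_iff_imp]
      rintro ⟨W, hW, rfl⟩
      exact ZFSet.mem_powerset.2 ZFSet.sep_subset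
    refine ⟨𝒩, card_lt_of_forall_exists_eq (f := fun W : 𝒲 ↦ unionOver M α W.1)
      (fun z hz ↦ ?_) h1, fun N hN ↦ ?_, ?_⟩
    · obtain ⟨W, hW, rfl⟩ := hmem.1 hz
      exact ⟨⟨W, hW⟩, rfl⟩
    · obtain ⟨W, hW, rfl⟩ := hmem.1 hN
      have hE' : ∀ η ∈ W, ∀ ξ ∈ E η ∩ Iic η, M ξ ⊆ M η := fun η hη ↦ hE η (h𝒲' hW hη)
      refine ⟨(h3 W hW).isElementarySubmodel_unionOver hκ.aleph0_le (h𝒲 hW) hE'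
        fun ξ hξ ↦ hM.elementary ξ (h𝒲' hW hξ), (h3 W hW).isClosedUnder_unionOver (h𝒲 hW) hE'
        fun ξ hξ i hi f hf ↦
          (mem_unionOver (h𝒲 hW)).2 ⟨ξ, hξ, hM.closed ξ (h𝒲' hW hξ) i hi hf⟩, ?_⟩
      obtain ⟨η, hη⟩ := (h3 W hW).nonempty hκ.pos
      exact (mem_unionOver (h𝒲 hW)).2 ⟨η, hη, hM.param_mem η (h𝒲' hW hη)⟩
    · ext z
      rw [mem_initialUnion, ZFSet.mem_sUnion]
      constructor
      · rintro ⟨ξ, hξ, hz⟩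
        have : ξ ∈ ⋃₀ 𝒲 := h2 ▸ hξ
        obtain ⟨W, hW, hξW⟩ := this
        exact ⟨_, hmem.2 ⟨W, hW, rfl⟩, (mem_unionOver (h𝒲 hW)).2 ⟨ξ, hξW, hz⟩⟩
      · rintro ⟨N, hN, hz⟩
        obtain ⟨W, hW, rfl⟩ := hmem.1 hN
        obtain ⟨ξ, hξ, hz⟩ := (mem_unionOver (h𝒲 hW)).1 hz
        exact ⟨ξ, h𝒲 hW hξ, hz⟩

end ApproximationSequence
end Davies

namespace Davies

open ZFSet Ordinal Order Set FirstOrder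

/-! ### Existence of closed approximation sequences -/

section Existence

variable {θ κ μ : Cardinal.{u}} {p x N : ZFSet.{u}}

theorem card_setLanguage_le : setLanguage.card ≤ ℵ₀ := by
  have : Countable setLanguage.Symbols := by
    have : Countable (Σ n, MemRel n) := by
      refine Function.Injective.countable (f := fun _ ↦ ()) ?_
      rintro ⟨_, ⟨⟩⟩ ⟨_, ⟨⟩⟩ _
      rfl
    have : Countable (Σ n, setLanguage.Relations n) := this
    have : IsEmpty (Σ n, setLanguage.Functions n) := ⟨fun f ↦ nomatch f.2⟩
    unfold Language.Symbols
    infer_instance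
  exact mk_le_aleph0

/-- The downward **Löwenheim-Skolem theorem** for `H θ`. -/
theorem exists_elementarySubmodel (hκ : ℵ₀ ≤ κ) (hκθ : κ < θ) (hx : ∀ y ∈ x, y ∈ H θ)
    (hxκ : x.card ≤ κ) :
    ∃ N : ZFSet.{u}, x ⊆ N ∧ N.card ≤ κ ∧ IsElementarySubmodel (N : Set ZFSet.{u}) (H θ) := by
  have hle : #{y : H θ | y.1 ∈ x} ≤ Cardinal.lift.{u + 1} κ := by
    refine le_trans ?_ (Cardinal.lift_le.2 hxκ)
    rw [← cardinalMk_coe_sort]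
    exact mk_le_of_injective (f := fun y : {y : H θ | y.1 ∈ x} ↦ (⟨y.1.1, y.2⟩ : x))
      fun y y' h ↦ Subtype.ext (Subtype.ext (congrArg Subtype.val h :))
  have hH : Cardinal.lift.{u + 1} κ ≤ #(H θ) := by
    rw [← card_ord κ, ← Cardinal.mk_Iio_ordinal]
    exact mk_le_of_injective (f := fun i : Iio κ.ord ↦
      (⟨i.1.toZFSet, toZFSet_mem_H (i.2.trans (ord_lt_ord.2 hκθ))⟩ : H θ))
      fun i j h ↦ Subtype.ext (toZFSet_injective (congrArg Subtype.val h))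
  obtain ⟨S, hxS, hS⟩ := Language.exists_elementarySubstructure_card_eq setLanguage
    {y : H θ | y.1 ∈ x} (Cardinal.lift.{u + 1} κ) (by simpa using hκ)
    (by simpa using hle) (by
      refine (Cardinal.lift_le.2 card_setLanguage_le).trans ?_
      simpa using hκ) (by simpa using hH)
  have hSκ : #S = Cardinal.lift.{u + 1} κ := by simpa using hS
  have : Small.{u} S := by
    rw [← Cardinal.mk_out κ, ← Cardinal.mk_uLift] at hSκ
    obtain ⟨e⟩ := Cardinal.eq.1 hSκ
    exact small_of_injective e.injective
  let N : ZFSet.{u} := ZFSet.range (fun y : S ↦ y.1.1)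
  have hmem {z : ZFSet.{u}} : z ∈ N ↔ ∃ y : S, y.1.1 = z := ZFSet.mem_range
  refine ⟨N, fun y hy ↦ hmem.2 ⟨⟨⟨y, hx y hy⟩, hxS hy⟩, rfl⟩, card_range_le _ hSκ.le,
    isElementarySubmodel_of_exists (fun z hz ↦ ?_) fun n φ v hv y hφ ↦ ?_⟩
  · obtain ⟨y, rfl⟩ := hmem.1 hz
    exact y.1.2
  · choose w hw using fun i ↦ hmem.1 (hv i)
    have hwv : S.subtype ∘ w = v := funext fun i ↦ Subtype.ext (hw i)
    have h1 : (φ.iExs Unit).Realize v := by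
      rw [Language.Formula.realize_iExs]
      exact ⟨fun _ ↦ y, hφ⟩
    rw [← hwv, S.subtype.map_formula, Language.Formula.realize_iExs] at h1
    obtain ⟨i, hi⟩ := h1
    rw [← S.subtype.map_formula] at hi
    refine ⟨(i ()).1, hmem.2 ⟨i (), rfl⟩, ?_⟩
    convert hi using 1
    funext k
    rcases k with k | k
    · exact congrFun hwv.symm k
    · rfl

theorem card_small_subsets_le (hGCH : GCH.{u}) (hκ : κ.IsRegular) (hx : x.card ≤ κ) :
    (ZFSet.sep (fun f ↦ f.card < κ) (ZFSet.powerset x)).card ≤ κ := by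
  have h := mk_small_subsets_le (κ := κ) hGCH hκ.aleph0_le hκ.cof_ord.ge
    (S := {z : ZFSet.{u} | z ∈ x}) (by
      refine le_trans (le_of_eq ?_) (Cardinal.lift_le.2 hx)
      rw [← cardinalMk_coe_sort]
      rfl)
  rw [← Cardinal.lift_le.{u + 1}, ← cardinalMk_coe_sort]
  refine le_trans ?_ h
  refine mk_le_of_injective (f := fun f : ZFSet.sep (fun f ↦ f.card < κ) (ZFSet.powerset x) ↦
    (⟨{z | z ∈ f.1}, ?_, ?_⟩ : {X : Set ZFSet.{u} | X ⊆ {z : ZFSet.{u} | z ∈ x} ∧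
      #X < Cardinal.lift.{u + 1} κ})) fun f g hfg ↦ ?_
  · exact fun z hz ↦ ZFSet.mem_powerset.1 (ZFSet.mem_sep.1 f.2).1 hz
  · have := (ZFSet.mem_sep.1 f.2).2
    rw [← Cardinal.lift_lt.{u, u + 1}, ← cardinalMk_coe_sort] at this
    exact this
  · refine Subtype.ext (ZFSet.ext fun z ↦ ?_)
    exact Set.ext_iff.1 (congrArg Subtype.val hfg) z

theorem card_prod_le (hκ : ℵ₀ ≤ κ) {y : ZFSet.{u}} (hx : x.card ≤ κ) (hy : y.card ≤ κ) :
    (ZFSet.prod x y).card ≤ κ := by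
  rw [← Cardinal.lift_le.{u + 1}, ← cardinalMk_coe_sort]
  have h1 : #(x × y) ≤ Cardinal.lift.{u + 1} κ := by
    rw [mk_prod, cardinalMk_coe_sort, cardinalMk_coe_sort]
    simp only [Cardinal.lift_id, ← Cardinal.lift_mul, Cardinal.lift_le]
    exact (mul_le_mul' hx hy).trans (mul_eq_self hκ).le
  refine le_trans (mk_le_of_surjective (f := fun q : x × y ↦
    (⟨pair q.1.1 q.2.1, pair_mem_prod.2 ⟨q.1.2, q.2.2⟩⟩ : ZFSet.prod x y)) ?_) h1
  rintro ⟨z, hz⟩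
  obtain ⟨a, ha, b, hb, rfl⟩ := mem_prod.1 hz
  exact ⟨(⟨a, ha⟩, ⟨b, hb⟩), rfl⟩

theorem card_le_of_mem_funs {α : Ordinal.{u}} {f : ZFSet.{u}} (hf : f ∈ funs α.toZFSet x) :
    f.card ≤ α.card := by
  obtain ⟨hf1, hf2⟩ := mem_funs.1 hf
  rw [← card_toZFSet, ← Cardinal.lift_le.{u + 1}, ← cardinalMk_coe_sort, ← cardinalMk_coe_sort]
  choose a ha b hb hab using fun z : f ↦ mem_prod.1 (hf1 z.2)
  refine mk_le_of_injective (f := fun z : f ↦ (⟨a z, ha z⟩ : α.toZFSet)) fun z z' h ↦ ?_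
  have h1 : a z = a z' := congrArg Subtype.val h
  have h2 : b z = b z' := (hf2 _ (ha z)).unique (hab z ▸ z.2) (h1 ▸ hab z' ▸ z'.2)
  exact Subtype.ext (by rw [hab z, hab z', h1, h2])

theorem exists_elementarySubmodel_funs_subset (hGCH : GCH.{u}) (hκ : κ.IsRegular) (hκθ : κ < θ)
    (hx : ∀ y ∈ x, y ∈ H θ) (hxκ : x.card ≤ κ) :
    ∃ N : ZFSet.{u}, x ⊆ N ∧ N.card ≤ κ ∧ IsElementarySubmodel (N : Set ZFSet.{u}) (H θ) ∧
      ∀ i < κ.ord, funs i.toZFSet x ⊆ N := by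
  have hθ : ℵ₀ ≤ θ := hκ.aleph0_le.trans hκθ.le
  let F := ZFSet.sep (fun f ↦ f.card < κ) (ZFSet.powerset (ZFSet.prod κ.ord.toZFSet x))
  have hxF : ∀ y ∈ x ∪ F, y ∈ H θ := by
    intro y hy
    rcases ZFSet.mem_union.1 hy with hy | hy
    · exact hx y hy
    · obtain ⟨hy1, hy2⟩ := ZFSet.mem_sep.1 hy
      refine mem_H_iff.2 ⟨hy2.trans hκθ, fun z hz ↦ ?_⟩
      obtain ⟨a, ha, b, hb, rfl⟩ := mem_prod.1 (ZFSet.mem_powerset.1 hy1 hz)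
      obtain ⟨i, hi, rfl⟩ := mem_toZFSet_iff.1 ha
      exact pair_mem_H hθ (toZFSet_mem_H (hi.trans (ord_lt_ord.2 hκθ))) (hx b hb)
  obtain ⟨N, h1, h2, h3⟩ := exists_elementarySubmodel hκ.aleph0_le hκθ hxF
    (card_union_le.trans ((add_le_add hxκ (card_small_subsets_le hGCH hκ
      (card_prod_le hκ.aleph0_le (by simp) hxκ))).trans (add_eq_self hκ.aleph0_le).le))
  refine ⟨N, fun y hy ↦ h1 (ZFSet.mem_union.2 (Or.inl hy)), h2, h3, fun i hi f hf ↦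
    h1 (ZFSet.mem_union.2 (Or.inr (ZFSet.mem_sep.2 ⟨ZFSet.mem_powerset.2 fun z hz ↦ ?_,
      (card_le_of_mem_funs hf).trans_lt (lt_ord.1 hi)⟩)))⟩
  obtain ⟨a, ha, b, hb, rfl⟩ := mem_prod.1 ((mem_funs.1 hf).1 hz)
  exact pair_mem_prod.2 ⟨toZFSet_subset_toZFSet_iff.2 hi.le ha, hb⟩

theorem exists_recursive_seq (F : ∀ α : Ordinal.{u}, (Iio α → ZFSet.{u}) → ZFSet.{u}) :
    ∃ M : Ordinal.{u} → ZFSet.{u}, ∀ α, M α = F α fun ξ ↦ M ξ :=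
  ⟨WellFoundedLT.fix fun α m ↦ F α fun ξ ↦ m ξ.1 ξ.2, fun α ↦ WellFoundedLT.fix_eq _ α⟩

theorem card_initialUnion_le (hκ : ℵ₀ ≤ κ) {M : Ordinal.{u} → ZFSet.{u}} {α : Ordinal.{u}}
    (hα : α.card ≤ κ) (h : ∀ ξ < α, (M ξ).card ≤ κ) : (initialUnion M α).card ≤ κ := by
  rw [← Cardinal.lift_le.{u + 1}, ← cardinalMk_coe_sort]
  have h1 : #(⋃ ξ : Iio α, {z : ZFSet.{u} | z ∈ M ξ.1}) ≤ Cardinal.lift.{u + 1} κ := by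
    refine mk_iUnion_le_of_le (by simpa using hκ) ?_ fun ξ ↦ ?_
    · rw [Cardinal.mk_Iio_ordinal]; exact Cardinal.lift_le.2 hα
    · refine le_trans (le_of_eq ?_) (Cardinal.lift_le.2 (h ξ.1 ξ.2))
      rw [← cardinalMk_coe_sort]
      rfl
  refine le_trans (mk_le_of_injective (f := fun z : initialUnion M α ↦
    (⟨z.1, ?_⟩ : ⋃ ξ : Iio α, {z : ZFSet.{u} | z ∈ M ξ.1})) fun z z' h ↦ ?_) h1
  · obtain ⟨ξ, hξ, hz⟩ := mem_initialUnion.1 z.2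
    exact Set.mem_iUnion.2 ⟨⟨ξ, hξ⟩, hz⟩
  · exact Subtype.ext (congrArg Subtype.val h :)

/-- The union of an increasing chain of length `κ` in which each stage contains all short sequences
from the previous stages; regularity of `κ` puts every short sequence of the union inside one stage.
-/
theorem exists_closed_elementarySubmodel (hGCH : GCH.{u}) (hκ : κ.IsRegular) (hκθ : κ < θ)
    (hx : ∀ y ∈ x, y ∈ H θ) (hxκ : x.card ≤ κ) :
    ∃ N : ZFSet.{u}, x ⊆ N ∧ N.card ≤ κ ∧ IsElementarySubmodel (N : Set ZFSet.{u}) (H θ) ∧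
      IsClosedUnder κ N := by
  have h (y : ZFSet.{u}) : ∃ N : ZFSet.{u}, (∀ z ∈ y, z ∈ H θ) → y.card ≤ κ → y ⊆ N ∧ N.card ≤ κ ∧
      IsElementarySubmodel (N : Set ZFSet.{u}) (H θ) ∧ ∀ i < κ.ord, funs i.toZFSet y ⊆ N := by
    by_cases hy : (∀ z ∈ y, z ∈ H θ) ∧ y.card ≤ κ
    · obtain ⟨N, hN⟩ := exists_elementarySubmodel_funs_subset hGCH hκ hκθ hy.1 hy.2
      exact ⟨N, fun _ _ ↦ hN⟩
    · exact ⟨∅, fun h1 h2 ↦ (hy ⟨h1, h2⟩).elim⟩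
  choose G hG using h
  obtain ⟨M, hM⟩ := exists_recursive_seq fun α m ↦ G (x ∪ ZFSet.iUnion m)
  replace hM (α) : M α = G (x ∪ initialUnion M α) := hM α
  have key (α) (hα : α < κ.ord) : (∀ z ∈ x ∪ initialUnion M α, z ∈ H θ) ∧
      (x ∪ initialUnion M α).card ≤ κ := by
    induction α using WellFoundedLT.induction with | ind α ih =>
    have hs (ξ) (hξ : ξ < α) := hG _ (ih ξ hξ (hξ.trans hα)).1 (ih ξ hξ (hξ.trans hα)).2
    simp only [← hM] at hs
    refine ⟨fun z hz ↦ ?_, card_union_le.trans ((add_le_add hxκ (card_initialUnion_le hκ.aleph0_le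
      (lt_ord.1 hα).le fun ξ hξ ↦ (hs ξ hξ).2.1)).trans (add_eq_self hκ.aleph0_le).le)⟩
    rcases ZFSet.mem_union.1 hz with hz | hz
    · exact hx z hz
    · obtain ⟨ξ, hξ, hz⟩ := mem_initialUnion.1 hz
      exact (hs ξ hξ).2.2.1.subset hz
  have hs (α) (hα : α < κ.ord) := hG _ (key α hα).1 (key α hα).2
  simp only [← hM] at hs
  have hmono {ξ η : Ordinal.{u}} (hη : η < κ.ord) (h : ξ ≤ η) : M ξ ⊆ M η := by
    rcases h.eq_or_lt with rfl | h
    · exact fun _ h ↦ h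
    · exact fun z hz ↦ (hs η hη).1 (ZFSet.mem_union.2 (Or.inr (mem_initialUnion.2 ⟨ξ, h, hz⟩)))
  have hcl : CoverClosed κ Iic (Iio κ.ord) := CoverClosed.Iio_of_isCovering
    (fun _ _ ↦ Subset.rfl) (fun χ h1 h2 ↦ (h1.not_gt h2).elim) le_rfl hκ.cof_ord.ge
  have h0 : (0 : Ordinal.{u}) < κ.ord := by rw [lt_ord, card_zero]; exact hκ.pos
  refine ⟨initialUnion M κ.ord, fun y hy ↦ mem_initialUnion.2 ⟨0, h0, (hs 0 h0).1
      (ZFSet.mem_union.2 (Or.inl hy))⟩, card_initialUnion_le hκ.aleph0_le (by simp)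
      fun ξ hξ ↦ (hs ξ hξ).2.1, ?_, ?_⟩ <;> rw [← unionOver_Iio]
  · exact hcl.isElementarySubmodel_unionOver hκ.aleph0_le Subset.rfl
      (fun η hη ξ hξ ↦ hmono hη hξ.2) fun ξ hξ ↦ (hs ξ hξ).2.2.1
  · refine hcl.isClosedUnder_unionOver Subset.rfl
      (fun η hη ξ hξ ↦ hmono hη hξ.2) fun ξ hξ i hi f hf ↦ ?_
    have hξ' : succ ξ < κ.ord := (isSuccLimit_ord hκ.aleph0_le).succ_lt hξ
    refine (mem_unionOver Subset.rfl).2 ⟨succ ξ, hξ', (hs _ hξ').2.2.2 i hi ?_⟩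
    obtain ⟨hf1, hf2⟩ := mem_funs.1 hf
    refine mem_funs.2 ⟨fun z hz ↦ ?_, hf2⟩
    obtain ⟨a, ha, b, hb, rfl⟩ := mem_prod.1 (hf1 hz)
    exact pair_mem_prod.2 ⟨ha, ZFSet.mem_union.2 (Or.inr (mem_initialUnion.2
      ⟨ξ, lt_succ ξ, hb⟩))⟩

/-- The domain `α < κ⁺` of `f` is in `N` and has size at most `κ ⊆ N`, so `α ⊆ N`, and `N` computes
the values of `f` at its elements. -/
theorem IsElementarySubmodel.isWeaklyClosedUnder [hθ : Fact θ.IsRegular]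
    (hN : IsElementarySubmodel (N : Set ZFSet.{u}) (H θ)) (hcl : IsClosedUnder κ N)
    (hκN : κ.ord.toZFSet ∈ N) (hκθ : succ κ ≤ θ) : IsWeaklyClosedUnder θ (succ κ) N := by
  rintro f hfN α hα ⟨Y, -, hf⟩
  obtain ⟨hf1, hf2⟩ := mem_funs.1 hf
  have hκN' : ∀ z ∈ κ.ord.toZFSet, z ∈ N := fun z hz ↦ by
    obtain ⟨i, hi, rfl⟩ := mem_toZFSet_iff.1 hz
    exact toZFSet_mem_of_isClosedUnder ((le_succ κ).trans hκθ) hN hcl hi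
  have hαN : α.toZFSet ∈ N := by
    refine hN.dom_mem hfN (toZFSet_mem_H (hα.trans_le (ord_le_ord.2 hκθ))) fun a ↦
      ⟨fun ha ↦ (hf2 a ha).exists, fun ⟨b, hb⟩ ↦ (pair_mem_prod.1 (hf1 hb)).1⟩
  have hsub := hN.subset_of_card_le hκN hκN' hαN (card_toZFSet_le_iff.2 hα)
  refine mem_funs.2 ⟨fun z hz ↦ ?_, hf2⟩
  obtain ⟨a, ha, b, hb, rfl⟩ := mem_prod.1 (hf1 hz)
  exact pair_mem_prod.2 ⟨ha, hN.mem_of_apply hfN (hsub a ha) hz fun c hc ↦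
    (hf2 a ha).unique hc hz⟩

theorem exists_isClosedLongApproxSeq [hθ : Fact θ.IsRegular] (hGCH : GCH.{u}) (hκ : κ.IsRegular)
    (hκμ : κ < μ) (hμθ : μ ≤ θ) (hp : p ∈ H θ) :
    ∃ M : Ordinal.{u} → ZFSet.{u}, IsClosedLongApproxSeq κ θ p μ.ord M := by
  have hκθ : κ < θ := hκμ.trans_le hμθ
  have hκH : κ.ord.toZFSet ∈ H θ := toZFSet_mem_H (ord_lt_ord.2 hκθ)
  have h (s : ZFSet.{u}) : ∃ N : ZFSet.{u}, s ∈ H θ → ({p, s, κ.ord.toZFSet} : ZFSet.{u}) ⊆ N ∧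
      N.card ≤ κ ∧ IsElementarySubmodel (N : Set ZFSet.{u}) (H θ) ∧ IsClosedUnder κ N := by
    by_cases hs : s ∈ H θ
    · obtain ⟨N, hN⟩ := exists_closed_elementarySubmodel (x := {p, s, κ.ord.toZFSet})
        hGCH hκ hκθ (by
          intro y hy
          simp only [ZFSet.mem_insert_iff, ZFSet.mem_singleton] at hy
          rcases hy with rfl | rfl | rfl <;> assumption) (by
          refine (card_insert_le.trans (add_le_add_left (card_insert_le.trans
            (add_le_add_left card_singleton.le _)) _)).trans ?_
          refine le_trans ?_ hκ.aleph0_le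
          exact_mod_cast (natCast_lt_aleph0 (n := 3)).le)
      exact ⟨N, fun _ ↦ hN⟩
    · exact ⟨∅, fun h ↦ (hs h).elim⟩
  choose G hG using h
  obtain ⟨M, hM⟩ := exists_recursive_seq fun α m ↦
    G (ZFSet.range fun ξ ↦ pair ξ.1.toZFSet (m ξ))
  replace hM (α) : M α = G (initialSeq M α) := hM α
  have key (α) (hα : α < μ.ord) : initialSeq M α ∈ H θ := by
    induction α using WellFoundedLT.induction with | ind α ih =>
    refine initialSeq_mem_H hθ.out.aleph0_le (hα.trans_le (ord_le_ord.2 hμθ)) fun ξ hξ ↦ ?_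
    obtain ⟨-, h1, h2, -⟩ := hG _ (ih ξ hξ (hξ.trans hα))
    rw [hM]
    exact mem_H_iff.2 ⟨h1.trans_lt hκθ, fun z hz ↦ h2.subset hz⟩
  have hs (α) (hα : α < μ.ord) := hG _ (key α hα)
  simp only [← hM] at hs
  exact ⟨M,
    { elementary := fun α hα ↦ (hs α hα).2.2.1
      param_mem := fun α hα ↦ (hs α hα).1 (by simp)
      weaklyClosed := fun α hα ↦ (hs α hα).2.2.1.isWeaklyClosedUnder (hs α hα).2.2.2
        ((hs α hα).1 (by simp)) (succ_le_of_lt hκθ)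
      card_lt := fun α hα ↦ lt_succ_iff.2 (hs α hα).2.1
      initialSeq_mem := fun α hα ↦ (hs α hα).1 (by simp)
      closed := fun α hα ↦ (hs α hα).2.2.2 }⟩

end Existence
end Davies

theorem theorem3 (hGCH : Davies.GCH.{u}) (hVWS : Davies.VWS.{u})
    (κ μ : Cardinal.{u}) (hκ : κ.IsRegular) (hμ : μ.IsRegular) (hκμ : κ < μ) (p : ZFSet.{u}) :
    ∃ θ₀ : Cardinal.{u}, ∀ θ : Cardinal.{u}, θ.IsRegular → θ₀ ≤ θ →
      (∃ M : Ordinal.{u} → ZFSet.{u}, Davies.IsSageDaviesTree κ μ θ p M) ∧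
      (∀ M : Ordinal.{u} → ZFSet.{u},
        Davies.IsClosedLongApproxSeq κ θ p μ.ord M → Davies.IsSageDaviesTree κ μ θ p M) := by
  obtain ⟨θ₁, hθ₁⟩ := Davies.exists_mem_H p
  -- With `θ > μ`, every `χ < μ` satisfies `χ⁺ < θ`, so the codes of coverings lie in `H θ`; `θ₁`
  -- puts `p` there.
  refine ⟨max (Order.succ μ) θ₁, fun θ hθ hle ↦ ?_⟩
  have : Fact θ.IsRegular := ⟨hθ⟩
  have hμθ : μ < θ := Order.succ_le_iff.1 ((le_max_left _ _).trans hle)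
  have key (M) (hM : Davies.IsClosedLongApproxSeq κ θ p μ.ord M) :
      Davies.IsSageDaviesTree κ μ θ p M :=
    hM.isSageDaviesTree hGCH hVWS hκ hμ hκμ hμθ
  obtain ⟨M, hM⟩ := Davies.exists_isClosedLongApproxSeq hGCH hκ hκμ hμθ.le
    (hθ₁ θ ((le_max_right _ _).trans hle))
  exact ⟨⟨M, key M hM⟩, key⟩
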